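/- For $r\ge 1$ let $\mathrm{SC}(3,r)$ be a set of $3r$ points consisting of the three corners of a non-degenerate triangle in the plane together with $r-1$ distinct points in the interior of each of its three sides. A triangulation of a finite planar point set $S$ is a dissection of the convex hull of $S$ into non-degenerate triangles with vertices in $S$ such that no triangle contains a point of $S$ other than its vertices. Let $\mathsf{tr}(3,r)$ be the number of triangulations of $\mathrm{SC}(3,r)$. Then the following hold for every choice of the configurations $\mathrm{SC}(3,r)$. 1. For all $r\ge 2$, $$\mathsf{tr}(3,r)=2^{3r-4}-3\sum_{j=0}^{r-3}\binom{3r-4}{j}$$ (the sum being empty for $r=2$). 2. For all $r\ge 0$, $$\mathsf{tr}(3,r+2)=3\binom{3r+2}{r}+\sum_{j=0}^{r}\frac{5j+1}{2j+1}\binom{3j}{j}8^{r-j}.$$ 3. There is exactly one formal power series $g=g(x)\in\mathbb{Q}[[x]]$ with $g(1-g)^2=x$; the series $(1-3g)(2g-1)(4g^2-6g+1)$ has non-zero constant term, and $$\sum_{r\ge 1}\mathsf{tr}(3,r)\,x^{r-1}=\frac{10g^3-17g^2+7g-1}{(1-3g)(2g-1)(4g^2-6g+1)}.$$ -/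

import Mathlib

/-- The Euclidean plane. -/
abbrev Plane : Type := EuclideanSpace ℝ (Fin 2)

/-- Twice the signed area of the triangle `a b c`; it is positive exactly when `a, b, c` make a
strict left turn. -/
noncomputable def orient (a b c : Plane) : ℝ :=
  (b 0 - a 0) * (c 1 - a 1) - (b 1 - a 1) * (c 0 - a 0)

/-- `S` is the point set of a balanced subdivided convex polygon `SC(k, r)`: it consists of the
corners `V 0, …, V (k-1)` of a strictly convex `k`-gon (in counterclockwise order, indices modulo
`k`) together with `r - 1` points in the interior of each side. On the side from `V i` to
`V (i+1)`, the points are the ones with parameters `0 = s i 0 < s i 1 < ⋯ < s i r = 1`. -/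
def IsSubdividedPolygon (k r : ℕ) (S : Finset Plane) : Prop :=
  3 ≤ k ∧ ∃ (V : ZMod k → Plane) (s : ZMod k → ℕ → ℝ),
    (∀ i j : ZMod k, j ≠ i → j ≠ i + 1 → 0 < orient (V i) (V (i + 1)) (V j)) ∧
    (∀ i : ZMod k, s i 0 = 0 ∧ s i r = 1 ∧ StrictMonoOn (s i) (Set.Iic r)) ∧
    (S : Set Plane) =
      {p | ∃ i : ZMod k, ∃ j < r, p = AffineMap.lineMap (V i) (V (i + 1)) (s i j)}

/-- `T`, a finite set of triangles given by their sets of vertices, is a triangulation of the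
finite point set `S`: a dissection of the convex hull of `S` into non-degenerate triangles with
vertices in `S` (so that it is cut out by segments connecting points of `S`), where no triangle
contains a point of `S` other than its vertices. -/
structure IsTriangulation (S : Finset Plane) (T : Finset (Finset Plane)) : Prop where
  vertices_subset : ∀ t ∈ T, t ⊆ S
  card_eq_three : ∀ t ∈ T, t.card = 3
  nondegenerate : ∀ t ∈ T, AffineIndependent ℝ ((↑) : t → Plane)
  no_other_point : ∀ t ∈ T, ∀ p ∈ S, p ∈ convexHull ℝ (t : Set Plane) → p ∈ t
  interiors_disjoint : ∀ t ∈ T, ∀ u ∈ T, t ≠ u →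
    Disjoint (interior (convexHull ℝ (t : Set Plane))) (interior (convexHull ℝ (u : Set Plane)))
  cover : ⋃ t ∈ T, convexHull ℝ (t : Set Plane) = convexHull ℝ (S : Set Plane)

/-- The number of triangulations of a finite point set in the plane. -/
noncomputable def numTriangulations (S : Finset Plane) : ℕ :=
  {T : Finset (Finset Plane) | IsTriangulation S T}.ncard

/-! ### Signed areas and convexity in the plane -/

section Orientation

/-! List the points counterclockwise as `p 0, …, p (3r-1)`, starting at a corner `A`, and let `t i
j` count the triangulations of the points `p i, …, p j`, a single edge counting once. As for Catalan
numbers, exactly one triangle of a triangulation rests on the base `p i p j`; its apex `p k` splits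
the rest into triangulations of two shorter chains. Hence `t i j` is the sum of `t i k * t k j` over
the `k` for which `p i, p k, p j` are not collinear. This is `card_chainTriangulations`, carried by
`exists_base_triangle` (existence), `subset_or_subset` (no other triangle straddles the apex) and
`glue` (the converse). Only the collinear triples of indices enter, so the count does not depend on
the positions of the points on the sides.

The recursion is then solved explicitly. A chain inside one side has `t = 0` unless it is an edge.
Around one corner the recursion is Pascal's rule, giving a binomial coefficient
(`eq_choose_of_recursion`). For chains running from the first side over the whole second side to the
third, apexes inside the second side contribute a Vandermonde convolution of corner counts, and the
remaining apexes give a Pascal-type recursion, solved by a power of two minus partial row sums of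
Pascal's triangle (`eq_two_pow_sub_of_recursion`).

For the second formula, one binomial term is moved out of the partial sum. The remainder `2 ^ (3r+2)
- 3 * chooseSum (3r+2) (r+1)` grows by a factor 8 at each step, up to the correction `(3j).choose j
+ 3 * (3j).choose (j-1)`; unrolling gives the convolution with powers of 8. For the generating
function, the series of `(3n+a).choose n` equals `1 / ((1 - 3g) (1 - g)^a)` (`ternarySeries_mul`),
and `1 - 8x` factors as `(1 - 2g)(4g² - 6g + 1)`, so everything becomes rational in `g`. -/

lemma orient_rotate (a b c : Plane) : orient b c a = orient a b c := by
  simp only [orient]; ring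

lemma orient_swap (a b c : Plane) : orient b a c = -orient a b c := by
  simp only [orient]; ring

lemma orient_swap_right (a b c : Plane) : orient a c b = -orient a b c := by
  simp only [orient]; ring

@[simp] lemma orient_self_left (a b : Plane) : orient a a b = 0 := by
  simp only [orient]; ring

@[simp] lemma orient_self_right (a b : Plane) : orient a b b = 0 := by
  simp only [orient]; ring

@[simp] lemma orient_self_outer (a b : Plane) : orient a b a = 0 := by
  simp only [orient]; ring

lemma orient_combination (a b x y : Plane) {s t : ℝ} (h : s + t = 1) :
    orient a b (s • x + t • y) = s * orient a b x + t * orient a b y := by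
  obtain rfl : t = 1 - s := by linarith
  simp [orient]; ring

lemma orient_add_orient_add_orient (a b c x : Plane) :
    orient a b x + orient b c x + orient c a x = orient a b c := by
  simp only [orient]; ring

/-- The Plücker relation for the vectors from `b` to `a`, `c`, `x`, `y`. It tells on which side of
`b` the segment from `x` to `y` passes. -/
lemma orient_mul_sub_mul (a b c x y : Plane) :
    orient a b y * orient b c x - orient a b x * orient b c y =
      orient a b c * orient x b y := by
  simp only [orient]; ring

lemma continuous_orient (a b : Plane) : Continuous (orient a b) := by
  unfold orient; fun_prop

lemma convex_orient_nonneg (a b : Plane) : Convex ℝ {x | 0 ≤ orient a b x} := by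
  intro x hx y hy s t hs ht hst
  simp only [Set.mem_ofPred_eq] at *
  rw [orient_combination _ _ _ _ hst]
  positivity

lemma orient_nonneg_of_mem_convexHull {a b : Plane} {s : Set Plane}
    (h : ∀ x ∈ s, 0 ≤ orient a b x) {x : Plane} (hx : x ∈ convexHull ℝ s) :
    0 ≤ orient a b x :=
  convexHull_min (t := {x | 0 ≤ orient a b x}) h (convex_orient_nonneg a b) hx

lemma orient_nonpos_of_mem_convexHull {a b : Plane} {s : Set Plane}
    (h : ∀ x ∈ s, orient a b x ≤ 0) {x : Plane} (hx : x ∈ convexHull ℝ s) :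
    orient a b x ≤ 0 := by
  have := orient_nonneg_of_mem_convexHull (a := b) (b := a) (s := s)
    (fun x hx => by rw [orient_swap]; linarith [h x hx]) hx
  rw [orient_swap] at this; linarith

/-- Barycentric coordinates with respect to a triangle. -/
lemma eq_barycentric {a b c : Plane} (h : orient a b c ≠ 0) (x : Plane) :
    x = (orient b c x / orient a b c) • a + (orient c a x / orient a b c) • b +
      (orient a b x / orient a b c) • c := by
  ext i
  fin_cases i <;> simp <;> field_simp <;> simp only [orient] <;> ring

lemma Convex.mem_of_orient_nonneg {K : Set Plane} (hK : Convex ℝ K) {a b c x : Plane}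
    (ha : a ∈ K) (hb : b ∈ K) (hc : c ∈ K) (h : 0 < orient a b c) (h₁ : 0 ≤ orient a b x)
    (h₂ : 0 ≤ orient b c x) (h₃ : 0 ≤ orient c a x) : x ∈ K := by
  have key := hK.sum_mem (t := Finset.univ)
    (w := ![orient b c x / orient a b c, orient c a x / orient a b c, orient a b x / orient a b c])
    (z := ![a, b, c])
    (by intro i _; fin_cases i <;> simp <;> positivity)
    (by
      simp [Fin.sum_univ_three]
      rw [← add_div, ← add_div, ← orient_add_orient_add_orient a b c x, div_eq_one_iff_eq]
      · ring
      · rw [orient_add_orient_add_orient]; exact h.ne')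
    (by intro i _; fin_cases i <;> simp [ha, hb, hc])
  rw [eq_barycentric h.ne' x]
  simpa [Fin.sum_univ_three] using key

lemma mem_interior_convexHull_of_orient_pos {a b c x : Plane} (h₁ : 0 < orient a b x)
    (h₂ : 0 < orient b c x) (h₃ : 0 < orient c a x) :
    x ∈ interior (convexHull ℝ {a, b, c}) := by
  have hpos : 0 < orient a b c := by rw [← orient_add_orient_add_orient a b c x]; positivity
  refine interior_maximal (s := convexHull ℝ {a, b, c})
    (t := {x | 0 < orient a b x} ∩ {x | 0 < orient b c x} ∩ {x | 0 < orient c a x}) ?_ ?_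
    ⟨⟨h₁, h₂⟩, h₃⟩
  · rintro y ⟨⟨hy₁, hy₂⟩, hy₃⟩
    exact (convex_convexHull ℝ _).mem_of_orient_nonneg (subset_convexHull ℝ _ (by simp))
      (subset_convexHull ℝ _ (by simp)) (subset_convexHull ℝ _ (by simp)) hpos
      (le_of_lt hy₁) (le_of_lt hy₂) (le_of_lt hy₃)
  · exact ((isOpen_lt continuous_const (continuous_orient a b)).inter
      (isOpen_lt continuous_const (continuous_orient b c))).inter
      (isOpen_lt continuous_const (continuous_orient c a))

lemma orient_lineMap (a b x y : Plane) (s : ℝ) :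
    orient a b (AffineMap.lineMap x y s) = (1 - s) * orient a b x + s * orient a b y := by
  rw [AffineMap.lineMap_apply_module, orient_combination _ _ _ _ (by ring)]

lemma orient_pos_of_mem_interior {a b : Plane} (hab : a ≠ b) {s : Set Plane}
    (h : ∀ x ∈ s, 0 ≤ orient a b x) {x : Plane} (hx : x ∈ interior s) : 0 < orient a b x := by
  obtain ⟨y, hy⟩ : ∃ y, orient a b y < 0 := by
    by_contra! hcon
    apply hab
    -- The displacement is `b - a` turned clockwise by a right angle, so its orientation value is
    -- minus the squared length of `b - a`.
    have e := hcon (a + !₂[b 1 - a 1, -(b 0 - a 0)])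
    simp [orient] at e
    have e0 : b 0 - a 0 = 0 := by nlinarith [sq_nonneg (b 0 - a 0), sq_nonneg (b 1 - a 1)]
    have e1 : b 1 - a 1 = 0 := by nlinarith [sq_nonneg (b 0 - a 0), sq_nonneg (b 1 - a 1)]
    ext i; fin_cases i <;> simp <;> linarith
  have hc : Filter.Tendsto (fun s : ℝ => AffineMap.lineMap x y s) (nhdsWithin 0 (Set.Ioi 0))
      (nhds x) := by
    have : Continuous (fun s : ℝ => AffineMap.lineMap x y s) := AffineMap.lineMap_continuous
    simpa using (this.tendsto 0).mono_left nhdsWithin_le_nhds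
  have hev := hc.eventually (mem_interior_iff_mem_nhds.1 hx)
  obtain ⟨ε, hε, hpos⟩ := (hev.and self_mem_nhdsWithin).exists
  have h1 := h _ hε
  rw [orient_lineMap] at h1
  have hpos' : 0 < ε := hpos
  have h0 := h x (interior_subset hx)
  rcases h0.lt_or_eq with h0 | h0
  · exact h0
  · rw [← h0] at h1; nlinarith

lemma disjoint_interior_of_orient {a b : Plane} (hab : a ≠ b) {s t : Set Plane}
    (hs : ∀ x ∈ s, 0 ≤ orient a b x) (ht : ∀ x ∈ t, orient a b x ≤ 0) :
    Disjoint (interior s) (interior t) := by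
  rw [Set.disjoint_left]
  intro x hx hx'
  have := orient_pos_of_mem_interior hab hs hx
  linarith [ht x (interior_subset hx')]

lemma exists_lineMap_of_orient_eq_zero {a b c : Plane} (hab : a ≠ b) (h : orient a b c = 0) :
    ∃ s : ℝ, c = AffineMap.lineMap a b s := by
  simp only [orient] at h
  by_cases h0 : b 0 - a 0 = 0
  · have h1 : b 1 - a 1 ≠ 0 := by
      intro h1; apply hab
      ext i; fin_cases i <;> simp <;> linarith
    refine ⟨(c 1 - a 1) / (b 1 - a 1), ?_⟩
    simp only [h0] at h
    have h2 : c 0 - a 0 = 0 := by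
      have : (b 1 - a 1) * (c 0 - a 0) = 0 := by linarith
      simpa [h1] using this
    ext i; fin_cases i <;> simp [AffineMap.lineMap_apply, h0] <;>
      first | linarith | (field_simp; linarith)
  · refine ⟨(c 0 - a 0) / (b 0 - a 0), ?_⟩
    ext i; fin_cases i <;> simp [AffineMap.lineMap_apply] <;> field_simp <;> linarith

lemma orient_lineMap_lineMap_lineMap (a b : Plane) (r s t : ℝ) :
    orient (AffineMap.lineMap a b r) (AffineMap.lineMap a b s) (AffineMap.lineMap a b t) = 0 := by
  simp [orient, AffineMap.lineMap_apply]; ring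

lemma affineIndependent_iff_orient_ne_zero (a b c : Plane) :
    AffineIndependent ℝ ![a, b, c] ↔ orient a b c ≠ 0 := by
  rw [affineIndependent_iff_not_collinear_set, not_iff_not,
    collinear_iff_of_mem (p₀ := a) (by simp)]
  constructor
  · rintro ⟨v, hv⟩
    obtain ⟨s, rfl⟩ := hv b (by simp)
    obtain ⟨t, rfl⟩ := hv c (by simp)
    simp [orient]; ring
  · intro h
    by_cases hab : a = b
    · subst hab
      refine ⟨c - a, ?_⟩
      simp only [Set.mem_insert_iff, Set.mem_singleton_iff, forall_eq_or_imp, forall_eq]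
      exact ⟨⟨0, by simp⟩, ⟨0, by simp⟩, ⟨1, by simp⟩⟩
    · obtain ⟨s, rfl⟩ := exists_lineMap_of_orient_eq_zero hab h
      refine ⟨b - a, ?_⟩
      simp only [Set.mem_insert_iff, Set.mem_singleton_iff, forall_eq_or_imp, forall_eq]
      exact ⟨⟨0, by simp⟩, ⟨1, by simp⟩, ⟨s, by simp [AffineMap.lineMap_apply]⟩⟩

open scoped Classical in
lemma affineIndependent_coe_iff_orient_ne_zero {a b c : Plane} (hab : a ≠ b) (hac : a ≠ c)
    (hbc : b ≠ c) :
    AffineIndependent ℝ ((↑) : ({a, b, c} : Finset Plane) → Plane) ↔ orient a b c ≠ 0 := by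
  rw [← affineIndependent_iff_orient_ne_zero]
  constructor
  · intro h
    have hinj : Function.Injective (![⟨a, by simp⟩, ⟨b, by simp⟩, ⟨c, by simp⟩] :
        Fin 3 → ({a, b, c} : Finset Plane)) := by
      intro i j hij
      fin_cases i <;> fin_cases j <;> simp_all [Ne.symm]
    convert h.comp_embedding ⟨_, hinj⟩ using 1
    ext i : 1
    fin_cases i <;> rfl
  · intro h
    have h2 := h.range
    have h3 : Set.range ![a, b, c] = (({a, b, c} : Finset Plane) : Set Plane) := by
      ext x; simp [Matrix.range_cons, Matrix.range_empty]; tauto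
    rw [h3] at h2
    exact h2

/-- If a segment leaves a convex set `K` through its edge from `a` to `b`, then its part beyond
the line `a b` is in `K`. The factor `σ` takes care of the orientation. -/
lemma Convex.mem_of_segment_crossing {K : Set Plane} (hK : Convex ℝ K) {a b c x y z : Plane} {σ : ℝ}
    (ha : a ∈ K) (hb : b ∈ K) (hy : y ∈ K) (hA : 0 < σ * orient a b c)
    (hfz : 0 ≤ σ * orient a b z) (hD : 0 ≤ σ * orient y b z) (hhy : 0 ≤ σ * orient c a y)
    (hhz : 0 ≤ σ * orient c a z) (hx : x ∈ segment ℝ y z) (hf : σ * orient a b x < 0) :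
    x ∈ K := by
  have hσ : σ ≠ 0 := by rintro rfl; simp at hA
  have hA' : orient a b c ≠ 0 := by intro h; simp [h] at hA
  obtain ⟨s, t, hs, ht, hst, rfl⟩ := hx
  rw [orient_combination _ _ _ _ hst] at hf
  have hfy : σ * orient a b y < 0 := by
    by_contra! h
    nlinarith [mul_nonneg hs h, mul_nonneg ht hfz]
  obtain ⟨α, hα⟩ : ∃ α, α = σ * orient a b z := ⟨_, rfl⟩
  obtain ⟨β, hβ⟩ : ∃ β, β = -(σ * orient a b y) := ⟨_, rfl⟩
  have hα0 : 0 ≤ α := by rw [hα]; exact hfz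
  have hβpos : 0 < β := by linarith
  have hsum : 0 < α + β := by linarith
  -- `w` is the crossing point of the segment with the line `a b`. It lies between `a` and `b` by
  -- its barycentric coordinates, and `x` lies between `y` and `w`.
  obtain ⟨w, hw⟩ : ∃ w, w = (α / (α + β)) • y + (β / (α + β)) • z := ⟨_, rfl⟩
  have h1 : α / (α + β) + β / (α + β) = 1 := by field_simp
  have hfw : orient a b w = 0 := by
    rw [hw, orient_combination _ _ _ _ h1]; field_simp; rw [hα, hβ]; ring
  have hgw : orient b c w / orient a b c = σ * orient y b z / (α + β) := by
    have e := orient_mul_sub_mul a b c y z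
    rw [hw, orient_combination _ _ _ _ h1]
    field_simp
    rw [hα, hβ]
    linear_combination σ * e
  have hhw : orient c a w / orient a b c =
      (α / (α + β) * (σ * orient c a y) + β / (α + β) * (σ * orient c a z)) /
        (σ * orient a b c) := by
    rw [hw, orient_combination _ _ _ _ h1]
    field_simp
  have hwmem : w ∈ K := by
    have e := eq_barycentric hA' w
    rw [e, hfw]
    simp only [zero_div, zero_smul, add_zero]
    refine hK ha hb (by rw [hgw]; positivity) (by rw [hhw]; positivity) ?_
    rw [← add_div, div_eq_one_iff_eq hA', ← orient_add_orient_add_orient a b c w, hfw]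
    ring
  have hle : t * (α + β) ≤ β := by
    have hs' : s = 1 - t := by linarith
    rw [hs'] at hf
    nlinarith
  have hx' : s • y + t • z = (1 - t * (α + β) / β) • y + (t * (α + β) / β) • w := by
    rw [hw, smul_add, smul_smul, smul_smul, ← add_assoc, ← add_smul]
    congr 2
    · field_simp; linear_combination β * hst
    · field_simp
  rw [hx']
  refine hK hy hwmem ?_ (by positivity) (by ring)
  rw [sub_nonneg, div_le_one hβpos]; exact hle

end Orientation

/-! ### Weakly convex chains and their hulls -/

section Chains

/-- The points `p 0, …, p n` are distinct and go around a convex curve counterclockwise; it may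
contain line segments. -/
structure WeaklyConvex (p : ℕ → Plane) (n : ℕ) : Prop where
  ne : ∀ {i j}, i < j → j ≤ n → p i ≠ p j
  nonneg : ∀ {i k j}, i < k → k < j → j ≤ n → 0 ≤ orient (p i) (p k) (p j)

open scoped Classical in
/-- The set of the points `p i, …, p j`. -/
noncomputable def chain (p : ℕ → Plane) (i j : ℕ) : Finset Plane := (Finset.Icc i j).image p

lemma mem_chain {p : ℕ → Plane} {i j : ℕ} {x : Plane} :
    x ∈ chain p i j ↔ ∃ m, i ≤ m ∧ m ≤ j ∧ p m = x := by
  simp [chain, and_assoc]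

lemma chain_mono {p : ℕ → Plane} {i j i' j' : ℕ} (hi : i' ≤ i) (hj : j ≤ j') :
    chain p i j ⊆ chain p i' j' := by
  intro x hx
  obtain ⟨m, h₁, h₂, rfl⟩ := mem_chain.1 hx
  exact mem_chain.2 ⟨m, by omega, by omega, rfl⟩

namespace WeaklyConvex

variable {p : ℕ → Plane} {n i k j : ℕ} {x y z : Plane}

lemma eq_of_eq (hp : WeaklyConvex p n) {a b : ℕ} (ha : a ≤ n) (hb : b ≤ n) (h : p a = p b) :
    a = b := by
  rcases lt_trichotomy a b with hab | hab | hab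
  · exact absurd h (hp.ne hab hb)
  · exact hab
  · exact absurd h.symm (hp.ne hab ha)

lemma mem_chain_iff (hp : WeaklyConvex p n) (hj : j ≤ n) {m : ℕ} (hm : m ≤ n) :
    p m ∈ chain p i j ↔ i ≤ m ∧ m ≤ j := by
  rw [mem_chain]
  constructor
  · rintro ⟨m', h₁, h₂, h⟩
    have := hp.eq_of_eq (by omega) hm h
    omega
  · rintro ⟨h₁, h₂⟩
    exact ⟨m, h₁, h₂, rfl⟩

lemma nonneg_of_le (hp : WeaklyConvex p n) (hik : i ≤ k) (hkj : k ≤ j) (hj : j ≤ n) :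
    0 ≤ orient (p i) (p k) (p j) := by
  rcases hik.eq_or_lt with rfl | hik
  · simp
  rcases hkj.eq_or_lt with rfl | hkj
  · simp
  exact hp.nonneg hik hkj hj

/-- All points up to `p k` lie on the left of the line from `p k` to `p j`. -/
lemma orient_nonneg_before (hp : WeaklyConvex p n) (hkj : k ≤ j) (hj : j ≤ n)
    (hx : x ∈ convexHull ℝ (chain p i k : Set Plane)) : 0 ≤ orient (p k) (p j) x := by
  refine orient_nonneg_of_mem_convexHull ?_ hx
  intro y hy
  obtain ⟨m, h₁, h₂, rfl⟩ := mem_chain.1 hy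
  rw [orient_rotate]
  exact hp.nonneg_of_le h₂ hkj hj

/-- All points from `p k` on lie on the left of the line from `p i` to `p k`. -/
lemma orient_nonneg_after (hp : WeaklyConvex p n) (hik : i ≤ k) (hj : j ≤ n)
    (hx : x ∈ convexHull ℝ (chain p k j : Set Plane)) : 0 ≤ orient (p i) (p k) x := by
  refine orient_nonneg_of_mem_convexHull ?_ hx
  intro y hy
  obtain ⟨m, h₁, h₂, rfl⟩ := mem_chain.1 hy
  exact hp.nonneg_of_le hik h₁ (by omega)

/-- The points between `p i` and `p j` lie on the right of the line from `p i` to `p j`. -/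
lemma orient_nonpos_between (hp : WeaklyConvex p n) (hj : j ≤ n)
    (hx : x ∈ convexHull ℝ (chain p i j : Set Plane)) : orient (p i) (p j) x ≤ 0 := by
  refine orient_nonpos_of_mem_convexHull ?_ hx
  intro y hy
  obtain ⟨m, h₁, h₂, rfl⟩ := mem_chain.1 hy
  rw [orient_swap_right]
  linarith [hp.nonneg_of_le h₁ h₂ hj]

lemma orient_closing_nonneg (hp : WeaklyConvex p n) (hj : j ≤ n)
    (hx : x ∈ convexHull ℝ (chain p i j : Set Plane)) : 0 ≤ orient (p j) (p i) x := by
  rw [orient_swap]; linarith [hp.orient_nonpos_between hj hx]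

lemma orient_nonneg_hulls (hp : WeaklyConvex p n) (hj : j ≤ n)
    (hy : y ∈ convexHull ℝ (chain p i k : Set Plane))
    (hz : z ∈ convexHull ℝ (chain p k j : Set Plane)) : 0 ≤ orient y (p k) z := by
  rw [← orient_rotate]
  refine orient_nonneg_of_mem_convexHull ?_ hy
  intro w hw
  obtain ⟨m, h₁, h₂, rfl⟩ := mem_chain.1 hw
  rw [orient_rotate]
  exact hp.orient_nonneg_after h₂ hj hz

lemma mem_hull (h₁ : i ≤ k) (h₂ : k ≤ j) : p k ∈ convexHull ℝ (chain p i j : Set Plane) :=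
  subset_convexHull ℝ _ (mem_chain.2 ⟨k, h₁, h₂, rfl⟩)

lemma hull_mono {i' j' : ℕ} (hi : i' ≤ i) (hj : j ≤ j') :
    convexHull ℝ (chain p i j : Set Plane) ⊆ convexHull ℝ (chain p i' j' : Set Plane) :=
  convexHull_mono (by exact_mod_cast chain_mono hi hj)

/-- A chord decomposition of the region below a chain. -/
lemma hull_eq_union (hp : WeaklyConvex p n) (hik : i < k) (hkj : k < j) (hj : j ≤ n)
    (hA : 0 < orient (p i) (p k) (p j)) :
    convexHull ℝ (chain p i j : Set Plane) =
      convexHull ℝ {p i, p k, p j} ∪ (convexHull ℝ (chain p i k : Set Plane) ∪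
        convexHull ℝ (chain p k j : Set Plane)) := by
  apply Set.Subset.antisymm
  · intro x hx
    have hh := hp.orient_closing_nonneg hj hx
    have hun : (chain p i j : Set Plane) = (chain p i k : Set Plane) ∪ chain p k j := by
      ext x
      simp only [Finset.mem_coe, Set.mem_union, mem_chain]
      constructor
      · rintro ⟨m, h₁, h₂, rfl⟩
        rcases le_total m k with h | h
        · exact Or.inl ⟨m, h₁, h, rfl⟩
        · exact Or.inr ⟨m, h, h₂, rfl⟩
      · rintro (⟨m, h₁, h₂, rfl⟩ | ⟨m, h₁, h₂, rfl⟩)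
        · exact ⟨m, h₁, by omega, rfl⟩
        · exact ⟨m, by omega, h₂, rfl⟩
    -- Every point of the hull lies on a segment from the left hull to the right hull. If it is
    -- beyond a leg of the triangle, that segment crosses the leg and the point belongs to the hull
    -- beyond it.
    rw [hun, convexHull_union ⟨p i, mem_chain.2 ⟨i, le_rfl, hik.le, rfl⟩⟩
      ⟨p k, mem_chain.2 ⟨k, le_rfl, hkj.le, rfl⟩⟩, mem_convexJoin] at hx
    obtain ⟨y, hy, z, hz, hx⟩ := hx
    have hhy := hp.orient_closing_nonneg hj (hull_mono le_rfl hkj.le hy)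
    have hhz := hp.orient_closing_nonneg hj (hull_mono hik.le le_rfl hz)
    have hD := hp.orient_nonneg_hulls hj hy hz
    have hfz := hp.orient_nonneg_after hik.le hj hz
    have hgy := hp.orient_nonneg_before hkj.le hj hy
    rcases lt_or_ge (orient (p i) (p k) x) 0 with hf | hf
    · right; left
      exact (convex_convexHull ℝ _).mem_of_segment_crossing (σ := 1) (mem_hull le_rfl hik.le)
        (mem_hull hik.le le_rfl) hy (by simpa using hA) (by simpa using hfz) (by simpa using hD)
        (by simpa using hhy) (by simpa using hhz) hx (by simpa using hf)
    rcases lt_or_ge (orient (p k) (p j) x) 0 with hg | hg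
    · right; right
      have h_swap : ∀ a b c : Plane, -1 * orient a b c = orient b a c := fun a b c => by
        rw [orient_swap]; ring
      -- The mirror image of the previous case: traversing the triangle backwards reverses all
      -- orientations, hence `σ = -1`.
      refine (convex_convexHull ℝ _).mem_of_segment_crossing (σ := -1) (a := p j) (b := p k)
        (c := p i) (y := z) (z := y) (mem_hull hkj.le le_rfl)
        (mem_hull le_rfl hkj.le) hz ?_ ?_ ?_ ?_ ?_ (segment_symm ℝ y z ▸ hx) ?_ <;> rw [h_swap]
      · rwa [orient_rotate]
      · exact hgy
      · rwa [orient_rotate]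
      · exact hhz
      · exact hhy
      · exact hg
    · left
      exact (convex_convexHull ℝ _).mem_of_orient_nonneg (subset_convexHull ℝ _ (by simp))
        (subset_convexHull ℝ _ (by simp)) (subset_convexHull ℝ _ (by simp)) hA hf hg hh
  · refine Set.union_subset (convexHull_min ?_ (convex_convexHull ℝ _))
      (Set.union_subset (hull_mono le_rfl hkj.le) (hull_mono hik.le le_rfl))
    rintro x (rfl | rfl | rfl)
    · exact mem_hull le_rfl (by omega)
    · exact mem_hull hik.le hkj.le
    · exact mem_hull (by omega) le_rfl

end WeaklyConvex

end Chains

/-! ### Triangles of a triangulation and the base triangle -/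

section Triangles

namespace IsTriangulation

variable {S C : Finset Plane} {T : Finset (Finset Plane)} {u : Finset Plane} {a b c x : Plane}

open scoped Classical in
lemma orient_ne_zero (hT : IsTriangulation S T) (hu : u ∈ T) (ha : a ∈ u) (hb : b ∈ u)
    (hc : c ∈ u) (hab : a ≠ b) (hac : a ≠ c) (hbc : b ≠ c) : orient a b c ≠ 0 := by
  have hsub : ({a, b, c} : Finset Plane) ⊆ u := by
    intro x hx
    simp only [Finset.mem_insert, Finset.mem_singleton] at hx
    rcases hx with rfl | rfl | rfl <;> assumption
  have hcard : ({a, b, c} : Finset Plane).card = 3 := Finset.card_eq_three.2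
    ⟨a, b, c, hab, hac, hbc, rfl⟩
  have heq := Finset.eq_of_subset_of_card_le hsub (by rw [hT.card_eq_three u hu, hcard])
  have := hT.nondegenerate u hu
  rw [← heq] at this
  exact (affineIndependent_coe_iff_orient_ne_zero hab hac hbc).1 this

lemma mem_of_mem_segment (hT : IsTriangulation S T) (hu : u ∈ T) (ha : a ∈ u) (hb : b ∈ u)
    (hx : x ∈ S) (h : x ∈ segment ℝ a b) : x ∈ u :=
  hT.no_other_point u hu x hx (segment_subset_convexHull (by exact_mod_cast ha)
    (by exact_mod_cast hb) h)

lemma eq_or_eq_of_mem_segment (hT : IsTriangulation S T) (hu : u ∈ T) (ha : a ∈ u) (hb : b ∈ u)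
    (hx : x ∈ S) (h : x ∈ segment ℝ a b) : x = a ∨ x = b := by
  have hxu := hT.mem_of_mem_segment hu ha hb hx h
  by_contra! hne
  by_cases hab : a = b
  · subst hab; simp at h; exact hne.1 h
  refine hT.orient_ne_zero hu ha hb hxu hab hne.1.symm hne.2.symm ?_
  obtain ⟨s, t, -, -, hst, rfl⟩ := h
  rw [orient_combination _ _ _ _ hst]; simp

lemma interior_nonempty (hT : IsTriangulation S T) (hu : u ∈ T) :
    (interior (convexHull ℝ (u : Set Plane))).Nonempty := by
  rw [interior_convexHull_nonempty_iff_affineSpan_eq_top]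
  have h := hT.nondegenerate u hu
  have := (h.affineSpan_eq_top_iff_card_eq_finrank_add_one).2
    (by simp [hT.card_eq_three u hu])
  simpa using this

/-- An open set that misses the interior of a triangle misses the closure of that interior, which is
the whole triangle. -/
lemma disjoint_interior_convexHull (hT : IsTriangulation S T) (hu : u ∈ T) {t : Finset Plane}
    (ht : t ∈ T) (htu : t ≠ u) :
    Disjoint (interior (convexHull ℝ (t : Set Plane))) (convexHull ℝ (u : Set Plane)) := by
  have h := (hT.interiors_disjoint t ht u hu htu).closure_right isOpen_interior
  rw [(convex_convexHull ℝ _).closure_interior_eq_closure_of_nonempty_interior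
    (hT.interior_nonempty hu)] at h
  exact h.mono_right subset_closure

open scoped Classical in
/-- Cutting off a part of a triangulation along a line. -/
lemma restrict (hT : IsTriangulation S T) (hC : C ⊆ S) {q : Plane} (hq : q ∈ C)
    (hneg : orient a b q < 0) (hle : ∀ x ∈ C, orient a b x ≤ 0)
    (hsplit : ∀ u ∈ T, u ⊆ C ∨ ∀ x ∈ u, 0 ≤ orient a b x) :
    IsTriangulation C (T.filter (· ⊆ C)) where
  vertices_subset t ht := (Finset.mem_filter.1 ht).2
  card_eq_three t ht := hT.card_eq_three t (Finset.mem_filter.1 ht).1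
  nondegenerate t ht := hT.nondegenerate t (Finset.mem_filter.1 ht).1
  no_other_point t ht p hp := hT.no_other_point t (Finset.mem_filter.1 ht).1 p (hC hp)
  interiors_disjoint t ht u hu :=
    hT.interiors_disjoint t (Finset.mem_filter.1 ht).1 u (Finset.mem_filter.1 hu).1
  cover := by
    apply Set.Subset.antisymm
    · refine Set.iUnion₂_subset fun t ht => convexHull_mono ?_
      exact_mod_cast (Finset.mem_filter.1 ht).2
    · intro x hx
      have hclosed : IsClosed (⋃ t ∈ T.filter (· ⊆ C), convexHull ℝ (t : Set Plane)) :=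
        (Finset.finite_toSet _).isClosed_biUnion fun t _ =>
          t.finite_toSet.isClosed_convexHull ℝ
      -- A point on the cutting line might be covered only by triangles of the other side. Moving it
      -- slightly towards `q` makes its position strict, and the finite union of triangles is
      -- closed.
      have hc : Filter.Tendsto (fun s : ℝ => AffineMap.lineMap x q s) (nhdsWithin 0 (Set.Ioc 0 1))
          (nhds x) := by
        have : Continuous (fun s : ℝ => AffineMap.lineMap x q s) :=
          AffineMap.lineMap_continuous (R := ℝ)
        simpa using (this.tendsto 0).mono_left nhdsWithin_le_nhds
      have : (nhdsWithin (0 : ℝ) (Set.Ioc 0 1)).NeBot := by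
        rw [nhdsWithin_Ioc_eq_nhdsGT zero_lt_one]; infer_instance
      refine hclosed.mem_of_tendsto hc ?_
      filter_upwards [self_mem_nhdsWithin] with s hs
      have hmem : AffineMap.lineMap x q s ∈ convexHull ℝ (C : Set Plane) :=
        (convex_convexHull ℝ _).lineMap_mem hx (subset_convexHull ℝ _ hq) ⟨hs.1.le, hs.2⟩
      have hlt : orient a b (AffineMap.lineMap x q s) < 0 := by
        rw [orient_lineMap]
        have := orient_nonpos_of_mem_convexHull (by exact_mod_cast hle) hx
        nlinarith [hs.1, hs.2]
      have hmem' : AffineMap.lineMap x q s ∈ convexHull ℝ (S : Set Plane) :=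
        convexHull_mono (by exact_mod_cast hC) hmem
      rw [← hT.cover] at hmem'
      simp only [Set.mem_iUnion] at hmem' ⊢
      obtain ⟨u, hu, hxu⟩ := hmem'
      rcases hsplit u hu with h | h
      · exact ⟨u, Finset.mem_filter.2 ⟨hu, h⟩, hxu⟩
      · have := orient_nonneg_of_mem_convexHull (by exact_mod_cast h) hxu
        linarith

end IsTriangulation

namespace WeaklyConvex

variable {p : ℕ → Plane} {n i k j m l : ℕ} {T : Finset (Finset Plane)} {u : Finset Plane}

/-- If a point lies strictly between the ends of a chain, then the chain is straight. -/
lemma orient_eq_zero_of_between (hp : WeaklyConvex p n) (hj : j ≤ n) (him : i < m) (hmj : m < j)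
    {s : ℝ} (hs₀ : 0 < s) (hs₁ : s < 1) (hm : p m = AffineMap.lineMap (p i) (p j) s)
    (hil : i ≤ l) (hlj : l ≤ j) : orient (p i) (p j) (p l) = 0 := by
  have hle := hp.orient_nonpos_between hj (mem_hull hil hlj)
  rcases le_total l m with h | h
  · have := hp.nonneg_of_le h hmj.le hj
    rw [← orient_rotate, ← orient_rotate, ← orient_rotate, hm] at this
    have e : orient (p l) (AffineMap.lineMap (p i) (p j) s) (p j) =
        (1 - s) * orient (p i) (p j) (p l) := by
      simp [orient, AffineMap.lineMap_apply]; ring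
    rw [orient_rotate, orient_rotate, orient_rotate, e] at this
    nlinarith
  · have := hp.nonneg_of_le him.le h (by omega)
    have e : orient (p i) (AffineMap.lineMap (p i) (p j) s) (p l) =
        s * orient (p i) (p j) (p l) := by
      simp [orient, AffineMap.lineMap_apply]; ring
    rw [hm, e] at this
    nlinarith

open scoped Classical in
-- Some triangle covers the midpoint of the base. All points lie on one side of the base line, so
-- the midpoint is on an edge along that line. No chain point is strictly between the ends, so this
-- edge contains both ends, which must then be vertices of the triangle.
lemma exists_base_triangle (hp : WeaklyConvex p n) (hj : j ≤ n) (hij : i < j)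
    (hT : IsTriangulation (chain p i j) T) :
    ∃ k, i < k ∧ k < j ∧ 0 < orient (p i) (p k) (p j) ∧ {p i, p k, p j} ∈ T := by
  have hne := hp.ne hij hj
  have hiS : p i ∈ chain p i j := mem_chain.2 ⟨i, le_rfl, hij.le, rfl⟩
  have hjS : p j ∈ chain p i j := mem_chain.2 ⟨j, hij.le, le_rfl, rfl⟩
  obtain ⟨x, hx⟩ : ∃ x, x = AffineMap.lineMap (p i) (p j) (1 / 2 : ℝ) := ⟨_, rfl⟩
  have hx0 : orient (p i) (p j) x = 0 := by rw [hx, orient_lineMap]; simp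
  have hxS : x ∈ convexHull ℝ (chain p i j : Set Plane) := by
    rw [hx]
    exact (convex_convexHull ℝ _).lineMap_mem (mem_hull le_rfl hij.le) (mem_hull hij.le le_rfl)
      (by norm_num)
  rw [← hT.cover] at hxS
  simp only [Set.mem_iUnion] at hxS
  obtain ⟨u, hu, hxu⟩ := hxS
  have hsub := hT.vertices_subset u hu
  have hle : ∀ v ∈ u, orient (p i) (p j) v ≤ 0 := fun v hv =>
    hp.orient_nonpos_between hj (subset_convexHull ℝ _ (hsub hv))
  obtain ⟨a, b, c, hab, hac, hbc, rfl⟩ := Finset.card_eq_three.1 (hT.card_eq_three u hu)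
  -- not all vertices are on the base line
  have hnotall : ¬ ∀ v ∈ ({a, b, c} : Finset Plane), orient (p i) (p j) v = 0 := by
    intro h
    obtain ⟨r, hr⟩ := exists_lineMap_of_orient_eq_zero hne (h a (by simp))
    obtain ⟨s, hs⟩ := exists_lineMap_of_orient_eq_zero hne (h b (by simp))
    obtain ⟨t, ht⟩ := exists_lineMap_of_orient_eq_zero hne (h c (by simp))
    refine hT.orient_ne_zero hu (a := a) (b := b) (c := c) (by simp) (by simp) (by simp)
      hab hac hbc ?_
    rw [hr, hs, ht, orient_lineMap_lineMap_lineMap]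
  -- so no point of the chain is strictly between the end points
  have hnobetween : ∀ v ∈ chain p i j, ∀ s : ℝ, 0 < s → s < 1 →
      v ≠ AffineMap.lineMap (p i) (p j) s := by
    intro v hv s hs₀ hs₁ hvs
    obtain ⟨m, him, hmj, rfl⟩ := mem_chain.1 hv
    have him' : i < m := by
      refine lt_of_le_of_ne him ?_
      rintro rfl
      have := AffineMap.lineMap_injective ℝ hne (a₁ := 0) (a₂ := s) (by simpa using hvs)
      linarith
    have hmj' : m < j := by
      refine lt_of_le_of_ne hmj ?_
      rintro rfl
      have := AffineMap.lineMap_injective ℝ hne (a₁ := 1) (a₂ := s) (by simpa using hvs)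
      linarith
    apply hnotall
    intro w hw
    obtain ⟨l, hil, hlj, rfl⟩ := mem_chain.1 (hsub hw)
    exact hp.orient_eq_zero_of_between hj him' hmj' hs₀ hs₁ hvs hil hlj
  -- the midpoint is on an edge
  obtain ⟨v, hv, w, hw, hvw⟩ : ∃ v ∈ ({a, b, c} : Finset Plane), ∃ w ∈ ({a, b, c} : Finset Plane),
      x ∈ segment ℝ v w := by
    obtain ⟨y, hy₀, hy₁, hy⟩ := Finset.mem_convexHull'.1 hxu
    rw [Finset.sum_insert (by simp [hab, hac]), Finset.sum_insert (by simp [hbc]),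
      Finset.sum_singleton] at hy hy₁
    have ha0 := hy₀ a (by simp)
    have hb0 := hy₀ b (by simp)
    have hc0 := hy₀ c (by simp)
    have e : orient (p i) (p j) x = y a * orient (p i) (p j) a + y b * orient (p i) (p j) b
        + y c * orient (p i) (p j) c := by
      rw [← hy]
      obtain h : y c = 1 - y a - y b := by linarith
      rw [h]; simp [orient]; ring
    have hla := hle a (by simp)
    have hlb := hle b (by simp)
    have hlc := hle c (by simp)
    by_cases ha : y a = 0
    · exact ⟨b, by simp, c, by simp, y b, y c, hb0, hc0, by linarith, by rw [← hy, ha]; simp⟩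
    by_cases hb : y b = 0
    · exact ⟨a, by simp, c, by simp, y a, y c, ha0, hc0, by linarith, by rw [← hy, hb]; simp⟩
    by_cases hc : y c = 0
    · exact ⟨a, by simp, b, by simp, y a, y b, ha0, hb0, by linarith, by rw [← hy, hc]; simp⟩
    exfalso
    apply hnotall
    have ta := mul_nonpos_of_nonneg_of_nonpos ha0 hla
    have tb := mul_nonpos_of_nonneg_of_nonpos hb0 hlb
    have tc := mul_nonpos_of_nonneg_of_nonpos hc0 hlc
    rw [hx0] at e
    intro v hv
    simp only [Finset.mem_insert, Finset.mem_singleton] at hv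
    rcases hv with rfl | rfl | rfl
    · exact (mul_eq_zero.1 (by linarith : y v * orient (p i) (p j) v = 0)).resolve_left ha
    · exact (mul_eq_zero.1 (by linarith : y v * orient (p i) (p j) v = 0)).resolve_left hb
    · exact (mul_eq_zero.1 (by linarith : y v * orient (p i) (p j) v = 0)).resolve_left hc
  -- the edge is the base
  obtain ⟨s, t, hs, ht, hst, hxe⟩ := id hvw
  have hs0 : s ≠ 0 := by
    rintro rfl
    refine hnobetween w (hsub hw) (1 / 2) (by norm_num) (by norm_num) ?_
    rw [← hx, ← hxe]; simp at hst; simp [hst]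
  have ht0 : t ≠ 0 := by
    rintro rfl
    refine hnobetween v (hsub hv) (1 / 2) (by norm_num) (by norm_num) ?_
    rw [← hx, ← hxe]; simp at hst; simp [hst]
  have he := orient_combination (p i) (p j) v w hst
  rw [hxe, hx0] at he
  have tv := mul_nonpos_of_nonneg_of_nonpos hs (hle v hv)
  have tw := mul_nonpos_of_nonneg_of_nonpos ht (hle w hw)
  obtain ⟨r₁, hr₁⟩ := exists_lineMap_of_orient_eq_zero hne
    ((mul_eq_zero.1 (by linarith : s * orient (p i) (p j) v = 0)).resolve_left hs0)
  obtain ⟨r₂, hr₂⟩ := exists_lineMap_of_orient_eq_zero hne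
    ((mul_eq_zero.1 (by linarith : t * orient (p i) (p j) w = 0)).resolve_left ht0)
  have hr : s * r₁ + t * r₂ = 1 / 2 := by
    apply AffineMap.lineMap_injective ℝ hne
    rw [← hx, ← hxe, hr₁, hr₂]
    simp only [AffineMap.lineMap_apply_module, smul_add, smul_smul]
    obtain rfl : t = 1 - s := by linarith
    module
  have hout : ∀ {v : Plane} {r : ℝ}, v ∈ ({a, b, c} : Finset Plane) →
      v = AffineMap.lineMap (p i) (p j) r → r ≤ 0 ∨ 1 ≤ r := by
    intro v r hv hvr
    by_contra! h
    exact hnobetween v (hsub hv) r h.1 h.2 hvr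
  have hseg : ∀ q : ℝ, 0 ≤ q → q ≤ 1 →
      (AffineMap.lineMap (p i) (p j) q : Plane) ∈ segment ℝ v w := by
    intro q hq₀ hq₁
    have hmem : q ∈ segment ℝ r₁ r₂ := by
      rw [segment_eq_uIcc, Set.mem_uIcc]
      -- Two parameters on the same side of the open unit interval cannot have the weighted mean `1
      -- / 2`.
      rcases hout hv hr₁ with h₁ | h₁ <;> rcases hout hw hr₂ with h₂ | h₂
      · nlinarith
      · left; constructor <;> linarith
      · right; constructor <;> linarith
      · nlinarith
    have := Set.mem_image_of_mem (AffineMap.lineMap (p i) (p j) : ℝ →ᵃ[ℝ] Plane) hmem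
    rw [image_segment] at this
    rwa [hr₁, hr₂]
  have hiu := hT.mem_of_mem_segment hu hv hw hiS (by simpa using hseg 0 le_rfl zero_le_one)
  have hju := hT.mem_of_mem_segment hu hv hw hjS (by simpa using hseg 1 zero_le_one le_rfl)
  -- the third vertex
  obtain ⟨z, hz⟩ : ∃ z, (({a, b, c} : Finset Plane).erase (p i)).erase (p j) = {z} := by
    rw [← Finset.card_eq_one, Finset.card_erase_of_mem, Finset.card_erase_of_mem hiu,
      hT.card_eq_three _ hu]
    exact Finset.mem_erase.2 ⟨hne.symm, hju⟩
  have hzmem : z ∈ (({a, b, c} : Finset Plane).erase (p i)).erase (p j) := by rw [hz]; simp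
  simp only [Finset.mem_erase] at hzmem
  obtain ⟨hzj, hzi, hzu⟩ := hzmem
  have heq : ({a, b, c} : Finset Plane) = {p i, z, p j} := by
    rw [Finset.pair_comm z, ← hz, Finset.insert_erase (Finset.mem_erase.2 ⟨hne.symm, hju⟩),
      Finset.insert_erase hiu]
  obtain ⟨k, hik, hkj, rfl⟩ := mem_chain.1 (hsub hzu)
  have hik' : i < k := lt_of_le_of_ne hik (by rintro rfl; exact hzi rfl)
  have hkj' : k < j := lt_of_le_of_ne hkj (by rintro rfl; exact hzj rfl)
  refine ⟨k, hik', hkj', ?_, heq ▸ hu⟩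
  exact lt_of_le_of_ne (hp.nonneg hik' hkj' hj)
    (hT.orient_ne_zero hu hiu hzu hju hzi.symm hne hzj).symm

end WeaklyConvex

end Triangles

/-! ### Splitting a triangulation at the apex of its base triangle -/

section Decomposition

section

variable {p : ℕ → Plane} {i j : ℕ} {T : Finset (Finset Plane)} {u : Finset Plane}

open scoped Classical in
/-- The triangulations of a chain; a single edge has the empty triangulation. -/
noncomputable def chainTriangulations (p : ℕ → Plane) (i j : ℕ) :
    Finset (Finset (Finset Plane)) :=
  if j ≤ i + 1 then {∅} else (chain p i j).powerset.powerset.filter fun T =>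
    IsTriangulation (chain p i j) T

lemma mem_chainTriangulations_of_le (h : j ≤ i + 1) :
    T ∈ chainTriangulations p i j ↔ T = ∅ := by
  simp [chainTriangulations, h]

open scoped Classical in
lemma mem_chainTriangulations (h : i + 2 ≤ j) :
    T ∈ chainTriangulations p i j ↔ IsTriangulation (chain p i j) T := by
  rw [chainTriangulations, if_neg (by omega), Finset.mem_filter, and_iff_right_iff_imp]
  intro hT
  simp only [Finset.mem_powerset]
  exact fun t ht => Finset.mem_powerset.2 (hT.vertices_subset t ht)

/-- Only chains of at least three points have triangulations with a triangle. -/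
lemma subset_of_mem_chainTriangulations (hT : T ∈ chainTriangulations p i j) (hu : u ∈ T) :
    i + 2 ≤ j ∧ IsTriangulation (chain p i j) T ∧ u ⊆ chain p i j := by
  by_cases h : j ≤ i + 1
  · rw [mem_chainTriangulations_of_le h] at hT
    subst hT; simp at hu
  · have h2 := (mem_chainTriangulations (by omega)).1 hT
    exact ⟨by omega, h2, h2.vertices_subset u hu⟩

end

namespace WeaklyConvex

variable {p : ℕ → Plane} {n i k j m l : ℕ} {T T₁ T₂ : Finset (Finset Plane)}
  {u : Finset Plane} {x : Plane}

lemma eq_of_orient_eq_zero {a b c x : Plane} (hA : orient a b c ≠ 0) (h₁ : orient a b x = 0)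
    (h₂ : orient b c x = 0) : x = b := by
  have h := orient_add_orient_add_orient a b c x
  have e := eq_barycentric hA x
  rw [h₁, h₂] at e h
  have h' : orient c a x = orient a b c := by linarith
  rw [e, h', div_self hA]; simp

open scoped Classical in
/-- No triangle other than the base triangle has vertices on both sides of its apex. -/
lemma not_straddling (hp : WeaklyConvex p n) (hik : i < k) (hkj : k < j) (hj : j ≤ n)
    (hA : 0 < orient (p i) (p k) (p j)) (hT : IsTriangulation (chain p i j) T)
    (ht : {p i, p k, p j} ∈ T) (hu : u ∈ T) (htu : {p i, p k, p j} ≠ u) (him : i ≤ m) (hmk : m < k)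
    (hkl : k < l) (hlj : l ≤ j) (hml : i < m ∨ l < j) (hm : p m ∈ u) (hl : p l ∈ u) : False := by
  have hf_m := hp.orient_nonpos_between (by omega) (mem_hull (p := p) him hmk.le)
  have hg_m := hp.orient_nonneg_before hkj.le hj (mem_hull (p := p) him hmk.le)
  have hh_m := hp.orient_closing_nonneg hj (mem_hull (p := p) him (hmk.le.trans hkj.le))
  have hf_l := hp.orient_nonneg_after hik.le hj (mem_hull (p := p) hkl.le hlj)
  have hg_l := hp.orient_nonpos_between hj (mem_hull (p := p) hkl.le hlj)
  have hh_l := hp.orient_closing_nonneg hj (mem_hull (p := p) (hik.le.trans hkl.le) hlj)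
  have hD := hp.nonneg hmk hkl (by omega)
  have hid := orient_mul_sub_mul (p i) (p k) (p j) (p m) (p l)
  have hne_m : orient (p i) (p k) (p m) ≠ 0 ∨ orient (p k) (p j) (p m) ≠ 0 := by
    by_contra! h
    exact hp.ne hmk (by omega) (eq_of_orient_eq_zero hA.ne' h.1 h.2)
  have hne_l : orient (p i) (p k) (p l) ≠ 0 ∨ orient (p k) (p j) (p l) ≠ 0 := by
    by_contra! h
    exact hp.ne hkl (by omega) (eq_of_orient_eq_zero hA.ne' h.1 h.2).symm
  -- The weights are chosen so that at `x` the orientations with respect to the two legs agree. By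
  -- the Plücker relation the common value is a nonnegative multiple of `orient (p m) (p k) (p l)`:
  -- either `x` is the apex, or `x` is strictly on the inner side of both legs.
  obtain ⟨α, hα⟩ : ∃ α, α = orient (p i) (p k) (p l) - orient (p k) (p j) (p l) := ⟨_, rfl⟩
  obtain ⟨β, hβ⟩ : ∃ β, β = orient (p k) (p j) (p m) - orient (p i) (p k) (p m) := ⟨_, rfl⟩
  have hα0 : 0 < α := by
    rcases hne_l with h | h
    · have := lt_of_le_of_ne hf_l h.symm; linarith
    · have := lt_of_le_of_ne hg_l h; linarith
  have hβ0 : 0 < β := by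
    rcases hne_m with h | h
    · have := lt_of_le_of_ne hf_m h; linarith
    · have := lt_of_le_of_ne hg_m h.symm; linarith
  have hsum : 0 < α + β := by linarith
  have h1 : α / (α + β) + β / (α + β) = 1 := by field_simp
  obtain ⟨x, hx⟩ : ∃ x, x = (α / (α + β)) • p m + (β / (α + β)) • p l := ⟨_, rfl⟩
  have hseg : x ∈ segment ℝ (p m) (p l) := ⟨_, _, by positivity, by positivity, h1, hx.symm⟩
  have hfx : orient (p i) (p k) x =
      orient (p i) (p k) (p j) * orient (p m) (p k) (p l) / (α + β) := by
    rw [hx, orient_combination _ _ _ _ h1, ← hid]; field_simp; rw [hα, hβ]; ring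
  have hgx : orient (p k) (p j) x =
      orient (p i) (p k) (p j) * orient (p m) (p k) (p l) / (α + β) := by
    rw [hx, orient_combination _ _ _ _ h1, ← hid]; field_simp; rw [hα, hβ]; ring
  have hhx : orient (p j) (p i) x = α / (α + β) * orient (p j) (p i) (p m) +
      β / (α + β) * orient (p j) (p i) (p l) := by
    rw [hx, orient_combination _ _ _ _ h1]
  have hS : ∀ {q}, i ≤ q → q ≤ j → p q ∈ chain p i j := fun h h' => mem_chain.2 ⟨_, h, h', rfl⟩
  rcases hD.eq_or_lt with hD | hD
  · -- the apex lies on an edge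
    rw [← hD] at hfx hgx
    have hxk : x = p k := eq_of_orient_eq_zero hA.ne' (by simpa using hfx) (by simpa using hgx)
    rcases hT.eq_or_eq_of_mem_segment hu hm hl (hS hik.le hkj.le) (hxk ▸ hseg) with h | h
    · exact hp.ne hmk (by omega) h.symm
    · exact hp.ne hkl (by omega) h
  have hfx' : 0 < orient (p i) (p k) x := by rw [hfx]; positivity
  have hgx' : 0 < orient (p k) (p j) x := by rw [hgx]; positivity
  by_cases hh : orient (p j) (p i) (p m) = 0 ∧ orient (p j) (p i) (p l) = 0
  · -- the edge is on the base line
    have hij : p i ≠ p j := hp.ne (hik.trans hkj) hj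
    obtain ⟨r, hr⟩ := exists_lineMap_of_orient_eq_zero hij
      (by rw [orient_swap, hh.1, neg_zero] : orient (p i) (p j) (p m) = 0)
    obtain ⟨s, hs⟩ := exists_lineMap_of_orient_eq_zero hij
      (by rw [orient_swap, hh.2, neg_zero] : orient (p i) (p j) (p l) = 0)
    have hr0 : r ≤ 0 := by
      rw [hr, orient_lineMap, orient_self_outer] at hf_m
      nlinarith
    have hs1 : 1 ≤ s := by
      rw [hs, orient_lineMap, orient_self_right, orient_rotate] at hg_l
      nlinarith
    have hmem : ∀ q : ℝ, 0 ≤ q → q ≤ 1 →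
        (AffineMap.lineMap (p i) (p j) q : Plane) ∈ segment ℝ (p m) (p l) := by
      intro q hq₀ hq₁
      have hmem : q ∈ segment ℝ r s := by
        rw [segment_eq_uIcc, Set.mem_uIcc]
        left; constructor <;> linarith
      have := Set.mem_image_of_mem (AffineMap.lineMap (p i) (p j) : ℝ →ᵃ[ℝ] Plane) hmem
      rw [image_segment] at this
      rwa [hr, hs]
    have e₁ := hT.eq_or_eq_of_mem_segment hu hm hl (hS le_rfl (by omega))
      (by simpa using hmem 0 le_rfl zero_le_one)
    have e₂ := hT.eq_or_eq_of_mem_segment hu hm hl (hS (by omega) le_rfl)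
      (by simpa using hmem 1 zero_le_one le_rfl)
    rcases hml with h | h
    · rcases e₁ with e | e
      · exact hp.ne h (by omega) e
      · exact hp.ne (by omega : i < l) (by omega) e
    · rcases e₂ with e | e
      · exact hp.ne (by omega : m < j) (by omega) e.symm
      · exact hp.ne h (by omega) e.symm
  · have hhx' : 0 < orient (p j) (p i) x := by
      rw [hhx]
      rw [not_and_or] at hh
      rcases hh with h | h
      · have := lt_of_le_of_ne hh_m (Ne.symm h); positivity
      · have := lt_of_le_of_ne hh_l (Ne.symm h); positivity
    have hint := mem_interior_convexHull_of_orient_pos hfx' hgx' hhx'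
    have hdis := hT.disjoint_interior_convexHull hu ht htu
    rw [Set.disjoint_left] at hdis
    refine hdis (by simpa using hint) ?_
    exact segment_subset_convexHull (by exact_mod_cast hm) (by exact_mod_cast hl) hseg

open scoped Classical in
lemma subset_or_subset (hp : WeaklyConvex p n) (hik : i < k) (hkj : k < j) (hj : j ≤ n)
    (hA : 0 < orient (p i) (p k) (p j)) (hT : IsTriangulation (chain p i j) T)
    (ht : {p i, p k, p j} ∈ T) (hu : u ∈ T) (htu : {p i, p k, p j} ≠ u) :
    u ⊆ chain p i k ∨ u ⊆ chain p k j := by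
  by_contra! h
  have hsub := hT.vertices_subset u hu
  obtain ⟨⟨x, hx, hx'⟩, ⟨y, hy, hy'⟩⟩ := h.imp Finset.not_subset.1 Finset.not_subset.1
  obtain ⟨l, hil, hlj, rfl⟩ := mem_chain.1 (hsub hx)
  obtain ⟨m, him, hmj, rfl⟩ := mem_chain.1 (hsub hy)
  rw [hp.mem_chain_iff (by omega) (by omega)] at hx' hy'
  by_cases hml : i < m ∨ l < j
  · exact hp.not_straddling hik hkj hj hA hT ht hu htu him (by omega) (by omega) hlj hml hy hx
  obtain rfl : m = i := by omega
  obtain rfl : l = j := by omega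
  -- The two vertices are the ends of the base, which `not_straddling` does not cover. The third
  -- vertex is not the apex, so together with one of the ends it forms a straddling pair.
  obtain ⟨z, hz, hz'⟩ : ∃ z ∈ u, z ∉ ({p m, p k, p l} : Finset Plane) := by
    by_contra! hcon
    refine htu (Finset.eq_of_subset_of_card_le hcon ?_).symm
    rw [hT.card_eq_three u hu, hT.card_eq_three _ ht]
  obtain ⟨q, hmq, hql, rfl⟩ := mem_chain.1 (hsub hz)
  simp only [Finset.mem_insert, Finset.mem_singleton, not_or] at hz'
  have h₁ : q ≠ m := by rintro rfl; exact hz'.1 rfl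
  have h₂ : q ≠ k := by rintro rfl; exact hz'.2.1 rfl
  have h₃ : q ≠ l := by rintro rfl; exact hz'.2.2 rfl
  rcases lt_or_gt_of_ne h₂ with h | h
  · exact hp.not_straddling hik hkj hj hA hT ht hu htu hmq h hkj le_rfl (by omega) hz hx
  · exact hp.not_straddling hik hkj hj hA hT ht hu htu le_rfl hik h hql (by omega) hy hz

open scoped Classical in
-- The line through the leg `p i p k` cuts off this part. The point `p (i + 1)` is strictly beyond
-- it, since otherwise it would be a further point of the base triangle.
lemma restrict_left (hp : WeaklyConvex p n) (hik : i + 2 ≤ k) (hkj : k < j) (hj : j ≤ n)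
    (hA : 0 < orient (p i) (p k) (p j)) (hT : IsTriangulation (chain p i j) T)
    (ht : {p i, p k, p j} ∈ T) :
    IsTriangulation (chain p i k) (T.filter (· ⊆ chain p i k)) := by
  have hS : p (i + 1) ∈ chain p i j := mem_chain.2 ⟨i + 1, by omega, by omega, rfl⟩
  have hq : p (i + 1) ∈ chain p i k := mem_chain.2 ⟨i + 1, by omega, by omega, rfl⟩
  refine hT.restrict (a := p i) (b := p k) (q := p (i + 1)) (chain_mono le_rfl hkj.le) hq ?_ ?_ ?_
  · refine lt_of_le_of_ne (hp.orient_nonpos_between (by omega) (subset_convexHull ℝ _ hq)) ?_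
    intro h0
    have hmem := hT.no_other_point _ ht _ hS ((convex_convexHull ℝ _).mem_of_orient_nonneg
      (a := p i) (b := p k) (c := p j) (subset_convexHull ℝ _ (by simp))
      (subset_convexHull ℝ _ (by simp)) (subset_convexHull ℝ _ (by simp)) hA h0.ge
      (hp.orient_nonneg_before hkj.le hj (subset_convexHull ℝ _ hq))
      (hp.orient_closing_nonneg hj (subset_convexHull ℝ _ hS)))
    simp only [Finset.mem_insert, Finset.mem_singleton] at hmem
    rcases hmem with h | h | h
    all_goals have := hp.eq_of_eq (by omega) (by omega) h; omega
  · exact fun x hx => hp.orient_nonpos_between (by omega) (subset_convexHull ℝ _ hx)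
  · intro u hu
    by_cases htu : {p i, p k, p j} = u
    · right; subst htu; simp [hA.le]
    · refine (hp.subset_or_subset (by omega) hkj hj hA hT ht hu htu).imp_right fun h x hx => ?_
      exact hp.orient_nonneg_after (by omega) hj (subset_convexHull ℝ _ (h hx))

open scoped Classical in
lemma restrict_right (hp : WeaklyConvex p n) (hik : i < k) (hkj : k + 2 ≤ j) (hj : j ≤ n)
    (hA : 0 < orient (p i) (p k) (p j)) (hT : IsTriangulation (chain p i j) T)
    (ht : {p i, p k, p j} ∈ T) :
    IsTriangulation (chain p k j) (T.filter (· ⊆ chain p k j)) := by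
  have hS : p (k + 1) ∈ chain p i j := mem_chain.2 ⟨k + 1, by omega, by omega, rfl⟩
  have hq : p (k + 1) ∈ chain p k j := mem_chain.2 ⟨k + 1, by omega, by omega, rfl⟩
  refine hT.restrict (a := p k) (b := p j) (q := p (k + 1)) (chain_mono hik.le le_rfl) hq ?_ ?_ ?_
  · refine lt_of_le_of_ne (hp.orient_nonpos_between hj (subset_convexHull ℝ _ hq)) ?_
    intro h0
    have hmem := hT.no_other_point _ ht _ hS ((convex_convexHull ℝ _).mem_of_orient_nonneg
      (a := p i) (b := p k) (c := p j) (subset_convexHull ℝ _ (by simp))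
      (subset_convexHull ℝ _ (by simp)) (subset_convexHull ℝ _ (by simp)) hA
      (hp.orient_nonneg_after hik.le hj (subset_convexHull ℝ _ hq)) h0.ge
      (hp.orient_closing_nonneg hj (subset_convexHull ℝ _ hS)))
    simp only [Finset.mem_insert, Finset.mem_singleton] at hmem
    rcases hmem with h | h | h
    all_goals have := hp.eq_of_eq (by omega) (by omega) h; omega
  · exact fun x hx => hp.orient_nonpos_between hj (subset_convexHull ℝ _ hx)
  · intro u hu
    by_cases htu : {p i, p k, p j} = u
    · right; subst htu
      have : orient (p k) (p j) (p i) = orient (p i) (p k) (p j) := orient_rotate _ _ _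
      simp [this, hA.le]
    · refine (hp.subset_or_subset hik (by omega) hj hA hT ht hu htu).symm.imp_right fun h x hx => ?_
      exact hp.orient_nonneg_before (by omega) hj (subset_convexHull ℝ _ (h hx))

/-- A chain with a triangulation meets the segment between its ends only in the ends. -/
lemma not_between_of_mem_chainTriangulations (hp : WeaklyConvex p n) (hj : j ≤ n) (him : i < m)
    (hmj : m < j) (hT : T ∈ chainTriangulations p i j) {s : ℝ} (hs₀ : 0 ≤ s) (hs₁ : s ≤ 1) :
    p m ≠ AffineMap.lineMap (p i) (p j) s := by
  intro hm
  rw [mem_chainTriangulations (by omega)] at hT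
  obtain ⟨q, hiq, hqj, hpos, -⟩ := hp.exists_base_triangle hj (by omega) hT
  have hs₀' : s ≠ 0 := by rintro rfl; exact hp.ne him (by omega) (by simpa using hm.symm)
  have hs₁' : s ≠ 1 := by rintro rfl; exact hp.ne hmj (by omega) (by simpa using hm)
  have := hp.orient_eq_zero_of_between hj him hmj (lt_of_le_of_ne hs₀ hs₀'.symm)
    (lt_of_le_of_ne hs₁ hs₁') hm hiq.le hqj.le
  rw [orient_swap_right] at this
  linarith

/-- A single edge has no triangles but a nonempty hull; the segment accounts for this case and is
redundant for longer chains. -/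
lemma hull_subset (hT : T ∈ chainTriangulations p i j) (hij : i < j) :
    convexHull ℝ (chain p i j : Set Plane) ⊆
      segment ℝ (p i) (p j) ∪ ⋃ t ∈ T, convexHull ℝ (t : Set Plane) := by
  by_cases h : j ≤ i + 1
  · obtain rfl : j = i + 1 := by omega
    have e : (chain p i (i + 1) : Set Plane) = {p i, p (i + 1)} := by
      ext x
      simp only [Finset.mem_coe, mem_chain, Set.mem_insert_iff, Set.mem_singleton_iff]
      constructor
      · rintro ⟨m, h₁, h₂, rfl⟩
        obtain rfl | rfl : m = i ∨ m = i + 1 := by omega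
        · exact Or.inl rfl
        · exact Or.inr rfl
      · rintro (rfl | rfl)
        · exact ⟨i, by omega, by omega, rfl⟩
        · exact ⟨i + 1, by omega, by omega, rfl⟩
    rw [e, convexHull_pair]
    exact Set.subset_union_left
  · rw [← ((mem_chainTriangulations (by omega)).1 hT).cover]
    exact Set.subset_union_right

end WeaklyConvex

end Decomposition

/-! ### The Catalan-type recursion -/

section Counting

namespace WeaklyConvex

variable {p : ℕ → Plane} {n i k j m l : ℕ} {T T₁ T₂ : Finset (Finset Plane)}
  {u : Finset Plane} {x : Plane}

open scoped Classical in
-- A further chain point in the triangle would have to lie on one of its two legs, but a chain with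
-- a triangulation has no point between its ends.
lemma base_triangle_no_other_point (hp : WeaklyConvex p n) (hik : i < k) (hkj : k < j) (hj : j ≤ n)
    (hA : 0 < orient (p i) (p k) (p j)) (h₁ : T₁ ∈ chainTriangulations p i k)
    (h₂ : T₂ ∈ chainTriangulations p k j) (hx : x ∈ chain p i j)
    (hxt : x ∈ convexHull ℝ (({p i, p k, p j} : Finset Plane) : Set Plane)) :
    x ∈ ({p i, p k, p j} : Finset Plane) := by
  obtain ⟨m, him, hmj, rfl⟩ := mem_chain.1 hx
  have hrot : orient (p k) (p j) (p i) = orient (p i) (p k) (p j) := orient_rotate _ _ _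
  have hrot' : orient (p j) (p i) (p k) = orient (p i) (p k) (p j) := by
    rw [orient_rotate, orient_rotate]
  have hf : 0 ≤ orient (p i) (p k) (p m) :=
    orient_nonneg_of_mem_convexHull (by simp [hA.le]) hxt
  have hg : 0 ≤ orient (p k) (p j) (p m) :=
    orient_nonneg_of_mem_convexHull (by simp [hrot, hA.le]) hxt
  have hh : 0 ≤ orient (p j) (p i) (p m) :=
    orient_nonneg_of_mem_convexHull (by simp [hrot', hA.le]) hxt
  by_cases hmi : m = i
  · simp [hmi]
  by_cases hmk : m = k
  · simp [hmk]
  by_cases hmj' : m = j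
  · simp [hmj']
  exfalso
  rcases lt_or_gt_of_ne hmk with h | h
  · have hf' := hp.orient_nonpos_between (by omega) (mem_hull (p := p) him h.le)
    obtain ⟨s, hs⟩ := exists_lineMap_of_orient_eq_zero (hp.ne hik (by omega)) (hf'.antisymm hf)
    refine hp.not_between_of_mem_chainTriangulations (by omega) (by omega) h h₁ (s := s) ?_ ?_ hs
    · rw [hs, orient_lineMap, orient_self_right, hrot'] at hh
      nlinarith
    · rw [hs, orient_lineMap, orient_self_outer, hrot] at hg
      nlinarith
  · have hg' := hp.orient_nonpos_between hj (mem_hull (p := p) h.le hmj)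
    obtain ⟨s, hs⟩ := exists_lineMap_of_orient_eq_zero (hp.ne hkj (by omega)) (hg'.antisymm hg)
    refine hp.not_between_of_mem_chainTriangulations hj h (by omega) h₂ (s := s) ?_ ?_ hs
    · rw [hs, orient_lineMap, orient_self_right] at hf
      nlinarith
    · rw [hs, orient_lineMap, orient_self_outer, hrot'] at hh
      nlinarith

open scoped Classical in
-- The lines through the two legs separate the three pieces. A chain point beyond the apex that lies
-- in a triangle of the other piece would be on both lines, hence equal to the apex.
lemma glue (hp : WeaklyConvex p n) (hik : i < k) (hkj : k < j) (hj : j ≤ n)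
    (hA : 0 < orient (p i) (p k) (p j)) (h₁ : T₁ ∈ chainTriangulations p i k)
    (h₂ : T₂ ∈ chainTriangulations p k j) :
    IsTriangulation (chain p i j) (insert {p i, p k, p j} (T₁ ∪ T₂)) := by
  have hik' := hp.ne hik (by omega)
  have hkj' := hp.ne hkj (by omega)
  have hij' := hp.ne (hik.trans hkj) (by omega)
  have hrot : orient (p k) (p j) (p i) = orient (p i) (p k) (p j) := orient_rotate _ _ _
  have hft : ∀ x ∈ convexHull ℝ (({p i, p k, p j} : Finset Plane) : Set Plane),
      0 ≤ orient (p i) (p k) x := fun x hx =>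
    orient_nonneg_of_mem_convexHull (by simp [hA.le]) hx
  have hgt : ∀ x ∈ convexHull ℝ (({p i, p k, p j} : Finset Plane) : Set Plane),
      0 ≤ orient (p k) (p j) x := fun x hx =>
    orient_nonneg_of_mem_convexHull (by simp [hrot, hA.le]) hx
  have hull₁ : ∀ u ∈ T₁, convexHull ℝ (u : Set Plane) ⊆ convexHull ℝ (chain p i k : Set Plane) :=
    fun u hu => convexHull_mono (by exact_mod_cast (subset_of_mem_chainTriangulations h₁ hu).2.2)
  have hull₂ : ∀ u ∈ T₂, convexHull ℝ (u : Set Plane) ⊆ convexHull ℝ (chain p k j : Set Plane) :=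
    fun u hu => convexHull_mono (by exact_mod_cast (subset_of_mem_chainTriangulations h₂ hu).2.2)
  have hf₁ : ∀ u ∈ T₁, ∀ x ∈ convexHull ℝ (u : Set Plane), orient (p i) (p k) x ≤ 0 :=
    fun u hu x hx => hp.orient_nonpos_between (by omega) (hull₁ u hu hx)
  have hg₁ : ∀ u ∈ T₁, ∀ x ∈ convexHull ℝ (u : Set Plane), 0 ≤ orient (p k) (p j) x :=
    fun u hu x hx => hp.orient_nonneg_before hkj.le hj (hull₁ u hu hx)
  have hf₂ : ∀ u ∈ T₂, ∀ x ∈ convexHull ℝ (u : Set Plane), 0 ≤ orient (p i) (p k) x :=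
    fun u hu x hx => hp.orient_nonneg_after hik.le hj (hull₂ u hu hx)
  have hg₂ : ∀ u ∈ T₂, ∀ x ∈ convexHull ℝ (u : Set Plane), orient (p k) (p j) x ≤ 0 :=
    fun u hu x hx => hp.orient_nonpos_between hj (hull₂ u hu hx)
  have hcases : ∀ {P : Finset Plane → Prop}, P {p i, p k, p j} → (∀ u ∈ T₁, P u) →
      (∀ u ∈ T₂, P u) → ∀ u ∈ insert {p i, p k, p j} (T₁ ∪ T₂), P u := by
    intro P ht h h' u hu
    rw [Finset.mem_insert, Finset.mem_union] at hu
    rcases hu with rfl | hu | hu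
    exacts [ht, h u hu, h' u hu]
  refine ⟨hcases ?_ ?_ ?_, hcases ?_ ?_ ?_, hcases ?_ ?_ ?_, hcases ?_ ?_ ?_,
    hcases ?_ ?_ ?_, ?_⟩
  · intro x hx
    simp only [Finset.mem_insert, Finset.mem_singleton] at hx
    rcases hx with rfl | rfl | rfl
    · exact mem_chain.2 ⟨i, le_rfl, by omega, rfl⟩
    · exact mem_chain.2 ⟨k, by omega, by omega, rfl⟩
    · exact mem_chain.2 ⟨j, by omega, by omega, rfl⟩
  · exact fun u hu => (subset_of_mem_chainTriangulations h₁ hu).2.2.trans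
      (chain_mono le_rfl hkj.le)
  · exact fun u hu => (subset_of_mem_chainTriangulations h₂ hu).2.2.trans
      (chain_mono hik.le le_rfl)
  · exact Finset.card_eq_three.2 ⟨_, _, _, hik', hij', hkj', rfl⟩
  · exact fun u hu => (subset_of_mem_chainTriangulations h₁ hu).2.1.card_eq_three u hu
  · exact fun u hu => (subset_of_mem_chainTriangulations h₂ hu).2.1.card_eq_three u hu
  · exact (affineIndependent_coe_iff_orient_ne_zero hik' hij' hkj').2 hA.ne'
  · exact fun u hu => (subset_of_mem_chainTriangulations h₁ hu).2.1.nondegenerate u hu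
  · exact fun u hu => (subset_of_mem_chainTriangulations h₂ hu).2.1.nondegenerate u hu
  · exact fun x hx hxt => hp.base_triangle_no_other_point hik hkj hj hA h₁ h₂ hx hxt
  · intro u hu x hx hxu
    obtain ⟨m, him, hmj, rfl⟩ := mem_chain.1 hx
    rcases le_or_gt m k with h | h
    · exact (subset_of_mem_chainTriangulations h₁ hu).2.1.no_other_point u hu _
        (mem_chain.2 ⟨m, him, h, rfl⟩) hxu
    · have e₁ := (hf₁ u hu _ hxu).antisymm (hp.nonneg_of_le hik.le h.le (by omega))
      have e₂ := (hp.orient_nonpos_between hj (mem_hull (p := p) h.le hmj)).antisymm (hg₁ u hu _ hxu)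
      exact absurd (eq_of_orient_eq_zero hA.ne' e₁ e₂) (hp.ne h (by omega)).symm
  · intro u hu x hx hxu
    obtain ⟨m, him, hmj, rfl⟩ := mem_chain.1 hx
    rcases le_or_gt k m with h | h
    · exact (subset_of_mem_chainTriangulations h₂ hu).2.1.no_other_point u hu _
        (mem_chain.2 ⟨m, h, hmj, rfl⟩) hxu
    · have e₁ := (hp.orient_nonpos_between (by omega) (mem_hull (p := p) him h.le)).antisymm
        (hf₂ u hu _ hxu)
      have e₂ := (hg₂ u hu _ hxu).antisymm
        (hp.orient_nonneg_before hkj.le hj (mem_hull (p := p) him h.le))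
      exact absurd (eq_of_orient_eq_zero hA.ne' e₁ e₂) (hp.ne h (by omega))
  · exact hcases (fun h => absurd rfl h)
      (fun u hu _ => disjoint_interior_of_orient hik' hft (hf₁ u hu))
      (fun u hu _ => disjoint_interior_of_orient hkj' hgt (hg₂ u hu))
  · exact fun u hu => hcases
      (fun _ => (disjoint_interior_of_orient hik' hft (hf₁ u hu)).symm)
      (fun v hv => (subset_of_mem_chainTriangulations h₁ hu).2.1.interiors_disjoint u hu v hv)
      (fun v hv _ => (disjoint_interior_of_orient hik' (hf₂ v hv) (hf₁ u hu)).symm)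
  · exact fun u hu => hcases
      (fun _ => (disjoint_interior_of_orient hkj' hgt (hg₂ u hu)).symm)
      (fun v hv _ => disjoint_interior_of_orient hik' (hf₂ u hu) (hf₁ v hv))
      (fun v hv => (subset_of_mem_chainTriangulations h₂ hu).2.1.interiors_disjoint u hu v hv)
  · have hpair : ∀ {a b : Plane}, a ∈ ({p i, p k, p j} : Finset Plane) →
        b ∈ ({p i, p k, p j} : Finset Plane) →
        segment ℝ a b ⊆ convexHull ℝ (({p i, p k, p j} : Finset Plane) : Set Plane) :=
      fun ha hb => segment_subset_convexHull (by exact_mod_cast ha) (by exact_mod_cast hb)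
    have hcoe : (({p i, p k, p j} : Finset Plane) : Set Plane) = {p i, p k, p j} := by simp
    rw [hp.hull_eq_union hik hkj hj hA, Finset.set_biUnion_insert, Finset.set_biUnion_union, hcoe]
    rw [hcoe] at hpair
    apply Set.Subset.antisymm
    · exact Set.union_subset_union_right _ (Set.union_subset_union
        (Set.iUnion₂_subset hull₁) (Set.iUnion₂_subset hull₂))
    · refine Set.union_subset Set.subset_union_left (Set.union_subset ?_ ?_)
      · refine (hull_subset h₁ hik).trans (Set.union_subset_union (hpair (by simp) (by simp)) ?_)
        exact Set.subset_union_left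
      · refine (hull_subset h₂ hkj).trans (Set.union_subset_union (hpair (by simp) (by simp)) ?_)
        exact Set.subset_union_right

open scoped Classical in
lemma filter_eq_empty_of_edge (hT : IsTriangulation (chain p i j) T) :
    T.filter (· ⊆ chain p k (k + 1)) = ∅ := by
  rw [Finset.filter_eq_empty_iff]
  intro u hu hsub
  have h1 := Finset.card_le_card hsub
  have h2 : (chain p k (k + 1)).card ≤ (Finset.Icc k (k + 1)).card := Finset.card_image_le
  rw [hT.card_eq_three u hu] at h1
  rw [Nat.card_Icc] at h2
  omega

open scoped Classical in
/-- A triangulation is determined by its base triangle and by the triangulations of the two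
chains beyond the legs of this triangle. -/
lemma decompose (hp : WeaklyConvex p n) (hik : i < k) (hkj : k < j) (hj : j ≤ n)
    (hA : 0 < orient (p i) (p k) (p j)) (hT : IsTriangulation (chain p i j) T)
    (ht : {p i, p k, p j} ∈ T) :
    T.filter (· ⊆ chain p i k) ∈ chainTriangulations p i k ∧
    T.filter (· ⊆ chain p k j) ∈ chainTriangulations p k j ∧
    insert {p i, p k, p j} (T.filter (· ⊆ chain p i k) ∪ T.filter (· ⊆ chain p k j)) = T := by
  refine ⟨?_, ?_, ?_⟩
  · by_cases h : k ≤ i + 1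
    · obtain rfl : k = i + 1 := by omega
      rw [mem_chainTriangulations_of_le h]
      exact filter_eq_empty_of_edge hT
    · rw [mem_chainTriangulations (by omega)]
      exact hp.restrict_left (by omega) hkj hj hA hT ht
  · by_cases h : j ≤ k + 1
    · obtain rfl : j = k + 1 := by omega
      rw [mem_chainTriangulations_of_le h]
      exact filter_eq_empty_of_edge hT
    · rw [mem_chainTriangulations (by omega)]
      exact hp.restrict_right hik (by omega) hj hA hT ht
  · rw [← Finset.filter_or]
    apply Finset.Subset.antisymm
    · exact Finset.insert_subset ht (Finset.filter_subset _ _)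
    · intro u hu
      by_cases htu : {p i, p k, p j} = u
      · simp [htu]
      · exact Finset.mem_insert_of_mem (Finset.mem_filter.2
          ⟨hu, hp.subset_or_subset hik hkj hj hA hT ht hu htu⟩)

open scoped Classical in
-- The two subchains share only the apex, so no triangle lies in both, and both pieces can be read
-- off from the glued triangulation. This makes gluing injective for a fixed apex.
lemma filter_glue (hp : WeaklyConvex p n) (hik : i < k) (hkj : k < j) (hj : j ≤ n)
    (h₁ : T₁ ∈ chainTriangulations p i k) (h₂ : T₂ ∈ chainTriangulations p k j) :
    (insert {p i, p k, p j} (T₁ ∪ T₂)).filter (· ⊆ chain p i k) = T₁ ∧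
    (insert {p i, p k, p j} (T₁ ∪ T₂)).filter (· ⊆ chain p k j) = T₂ := by
  have hnot : ∀ u : Finset Plane, u.card = 3 → u ⊆ chain p i k → u ⊆ chain p k j → False := by
    intro u hu hu₁ hu₂
    have : u ⊆ {p k} := by
      intro x hx
      obtain ⟨m, -, hmk, rfl⟩ := mem_chain.1 (hu₁ hx)
      have := ((hp.mem_chain_iff hj (by omega)).1 (hu₂ hx)).1
      obtain rfl : m = k := by omega
      simp
    have := Finset.card_le_card this
    simp [hu] at this
  have hj_not : p j ∉ chain p i k := by
    rw [hp.mem_chain_iff (by omega) (by omega)]; omega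
  have hi_not : p i ∉ chain p k j := by
    rw [hp.mem_chain_iff (by omega) (by omega)]; omega
  constructor
  · ext u
    simp only [Finset.mem_filter, Finset.mem_insert, Finset.mem_union]
    constructor
    · rintro ⟨rfl | hu | hu, hsub⟩
      · exact absurd (hsub (by simp)) hj_not
      · exact hu
      · obtain ⟨-, hT, hu'⟩ := subset_of_mem_chainTriangulations h₂ hu
        exact (hnot u (hT.card_eq_three u hu) hsub hu').elim
    · exact fun hu => ⟨Or.inr (Or.inl hu), (subset_of_mem_chainTriangulations h₁ hu).2.2⟩
  · ext u
    simp only [Finset.mem_filter, Finset.mem_insert, Finset.mem_union]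
    constructor
    · rintro ⟨rfl | hu | hu, hsub⟩
      · exact absurd (hsub (by simp)) hi_not
      · obtain ⟨-, hT, hu'⟩ := subset_of_mem_chainTriangulations h₁ hu
        exact (hnot u (hT.card_eq_three u hu) hu' hsub).elim
      · exact hu
    · exact fun hu => ⟨Or.inr (Or.inr hu), (subset_of_mem_chainTriangulations h₂ hu).2.2⟩

open scoped Classical in
-- A second triangle on the base would lie in one of the two subchains, but neither contains both
-- ends. Thus different apexes give disjoint sets of triangulations.
lemma apex_unique (hp : WeaklyConvex p n) (hj : j ≤ n) {k' : ℕ} (hik : i < k) (hkj : k < j)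
    (hik' : i < k') (hkj' : k' < j) (hA : 0 < orient (p i) (p k) (p j))
    (hT : IsTriangulation (chain p i j) T) (ht : {p i, p k, p j} ∈ T)
    (ht' : {p i, p k', p j} ∈ T) : k = k' := by
  by_cases h : ({p i, p k, p j} : Finset Plane) = {p i, p k', p j}
  · have hk : p k' ∈ ({p i, p k, p j} : Finset Plane) := by rw [h]; simp
    simp only [Finset.mem_insert, Finset.mem_singleton] at hk
    rcases hk with h | h | h
    all_goals have := hp.eq_of_eq (by omega) (by omega) h; omega
  · exfalso
    rcases hp.subset_or_subset hik hkj hj hA hT ht ht' h with h | h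
    · have := h (by simp : p j ∈ ({p i, p k', p j} : Finset Plane))
      rw [hp.mem_chain_iff (by omega) (by omega)] at this
      omega
    · have := h (by simp : p i ∈ ({p i, p k', p j} : Finset Plane))
      rw [hp.mem_chain_iff (by omega) (by omega)] at this
      omega

lemma card_chainTriangulations_edge : (chainTriangulations p i (i + 1)).card = 1 := by
  simp [chainTriangulations]

open scoped Classical in
/-- The recursion of Catalan type for the number of triangulations of a chain. -/
theorem card_chainTriangulations (hp : WeaklyConvex p n) (hij : i + 2 ≤ j) (hj : j ≤ n) :
    (chainTriangulations p i j).card =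
      ∑ k ∈ (Finset.Ioo i j).filter (fun k => 0 < orient (p i) (p k) (p j)),
        (chainTriangulations p i k).card * (chainTriangulations p k j).card := by
  have hunion : chainTriangulations p i j =
      ((Finset.Ioo i j).filter (fun k => 0 < orient (p i) (p k) (p j))).biUnion fun k =>
        (chainTriangulations p i k ×ˢ chainTriangulations p k j).image fun x =>
          insert {p i, p k, p j} (x.1 ∪ x.2) := by
    ext T
    simp only [Finset.mem_biUnion, Finset.mem_filter, Finset.mem_Ioo, Finset.mem_image,
      Finset.mem_product, Prod.exists]
    constructor
    · intro hT
      rw [mem_chainTriangulations hij] at hT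
      obtain ⟨k, hik, hkj, hA, ht⟩ := hp.exists_base_triangle hj (by omega) hT
      obtain ⟨h₁, h₂, h⟩ := hp.decompose hik hkj hj hA hT ht
      exact ⟨k, ⟨⟨hik, hkj⟩, hA⟩, _, _, ⟨h₁, h₂⟩, h⟩
    · rintro ⟨k, ⟨⟨hik, hkj⟩, hA⟩, T₁, T₂, ⟨h₁, h₂⟩, rfl⟩
      rw [mem_chainTriangulations hij]
      exact hp.glue hik hkj hj hA h₁ h₂
  rw [hunion, Finset.card_biUnion]
  · refine Finset.sum_congr rfl fun k hk => ?_
    simp only [Finset.mem_filter, Finset.mem_Ioo] at hk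
    rw [Finset.card_image_of_injOn, Finset.card_product]
    rintro ⟨T₁, T₂⟩ h ⟨T₁', T₂'⟩ h' heq
    simp only [Finset.mem_coe, Finset.mem_product] at h h' heq
    obtain ⟨e₁, e₂⟩ := hp.filter_glue hk.1.1 hk.1.2 hj h.1 h.2
    obtain ⟨e₁', e₂'⟩ := hp.filter_glue hk.1.1 hk.1.2 hj h'.1 h'.2
    rw [heq] at e₁ e₂
    rw [← e₁, ← e₂, e₁', e₂']
  · intro k hk k' hk' hne
    simp only [Finset.coe_filter, Finset.mem_Ioo, Set.mem_ofPred_eq] at hk hk'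
    rw [Function.onFun, Finset.disjoint_left]
    rintro T hT hT'
    simp only [Finset.mem_image, Finset.mem_product, Prod.exists] at hT hT'
    obtain ⟨T₁, T₂, ⟨h₁, h₂⟩, rfl⟩ := hT
    obtain ⟨T₁', T₂', -, h⟩ := hT'
    refine hne (hp.apex_unique hj hk.1.1 hk.1.2 hk'.1.1 hk'.1.2 hk.2
      (hp.glue hk.1.1 hk.1.2 hj hk.2 h₁ h₂) (by simp) ?_)
    rw [← h]; simp

end WeaklyConvex

end Counting

/-! ### Orientations in the subdivided triangle -/

section SubdividedTriangle

/-- The points of a triangle with subdivided sides, in counterclockwise order; the parameters of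
the points on the three sides are `a`, `b` and `c`. -/
noncomputable def trianglePoint (A B C : Plane) (a b c : ℕ → ℝ) (r m : ℕ) : Plane :=
  if m < r then AffineMap.lineMap A B (a m)
  else if m < 2 * r then AffineMap.lineMap B C (b (m - r))
  else AffineMap.lineMap C A (c (m - 2 * r))

/-- The three points with indices `i < k < j` are on one side of the triangle. -/
def OnOneSide (r i k j : ℕ) : Prop :=
  j ≤ r ∨ (r ≤ i ∧ j ≤ 2 * r) ∨ 2 * r ≤ i ∨ (i = 0 ∧ 2 * r ≤ k)

variable {A B C : Plane} {a b c : ℕ → ℝ} {r : ℕ}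

/-- For each distribution of the points over the sides, the orientation is `orient A B C` times a
polynomial in the side parameters that is visibly nonnegative. The corner `A` occurs only as index 0
although it also ends the third side; this causes the last alternative of `OnOneSide`. -/
lemma orient_trianglePoint (hΔ : 0 < orient A B C)
    (ha : a 0 = 0 ∧ a r = 1 ∧ StrictMonoOn a (Set.Iic r))
    (hb : b 0 = 0 ∧ b r = 1 ∧ StrictMonoOn b (Set.Iic r))
    (hc : c 0 = 0 ∧ c r = 1 ∧ StrictMonoOn c (Set.Iic r))
    {i k j : ℕ} (hik : i < k) (hkj : k < j) (hj : j < 3 * r) :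
    0 ≤ orient (trianglePoint A B C a b c r i) (trianglePoint A B C a b c r k)
      (trianglePoint A B C a b c r j) ∧
    (0 < orient (trianglePoint A B C a b c r i) (trianglePoint A B C a b c r k)
      (trianglePoint A B C a b c r j) ↔ ¬ OnOneSide r i k j) := by
  have param : ∀ {s : ℕ → ℝ}, (s 0 = 0 ∧ s r = 1 ∧ StrictMonoOn s (Set.Iic r)) →
      ∀ {m}, m < r → 0 ≤ s m ∧ s m < 1 := by
    rintro s ⟨h₀, h₁, h⟩ m hm
    rw [← h₀, ← h₁]
    exact ⟨h.monotoneOn (by simp) (by simp; omega) (by omega),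
      h (by simp; omega) (by simp) hm⟩
  have mono : ∀ {s : ℕ → ℝ}, (s 0 = 0 ∧ s r = 1 ∧ StrictMonoOn s (Set.Iic r)) →
      ∀ {m m'}, m < m' → m' < r → s m < s m' := by
    rintro s ⟨-, -, h⟩ m m' hm hm'
    exact h (by simp; omega) (by simp; omega) hm
  have pos : ∀ {s : ℕ → ℝ}, (s 0 = 0 ∧ s r = 1 ∧ StrictMonoOn s (Set.Iic r)) →
      ∀ {m}, 0 < m → m < r → 0 < s m := by
    intro s hs m hm hm'
    have := mono hs hm hm'
    rwa [hs.1] at this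
  have e₁ : ∀ {m}, m < r → trianglePoint A B C a b c r m = AffineMap.lineMap A B (a m) :=
    fun h => by rw [trianglePoint, if_pos h]
  have e₂ : ∀ {m}, r ≤ m → m < 2 * r →
      trianglePoint A B C a b c r m = AffineMap.lineMap B C (b (m - r)) :=
    fun h h' => by rw [trianglePoint, if_neg (by omega), if_pos h']
  have e₃ : ∀ {m}, 2 * r ≤ m →
      trianglePoint A B C a b c r m = AffineMap.lineMap C A (c (m - 2 * r)) :=
    fun h => by rw [trianglePoint, if_neg (by omega), if_neg (by omega)]
  have of_pos : ∀ {t : ℝ}, 0 < t → ¬ OnOneSide r i k j → 0 ≤ t ∧ (0 < t ↔ ¬ OnOneSide r i k j) :=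
    fun h h' => ⟨h.le, iff_of_true h h'⟩
  have of_zero : ∀ {t : ℝ}, t = 0 → OnOneSide r i k j → 0 ≤ t ∧ (0 < t ↔ ¬ OnOneSide r i k j) :=
    fun h h' => ⟨h.ge, iff_of_false (by rw [h]; exact lt_irrefl 0) (not_not.2 h')⟩
  rcases lt_or_ge i r with hi | hi
  · rw [e₁ hi]
    have hai := param ha hi
    rcases lt_or_ge k r with hk | hk
    · rw [e₁ hk]
      have hak := mono ha hik hk
      rcases lt_or_ge j r with hj₁ | hj₁
      · rw [e₁ hj₁]
        exact of_zero (orient_lineMap_lineMap_lineMap _ _ _ _ _) (by unfold OnOneSide; omega)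
      rcases lt_or_ge j (2 * r) with hj₂ | hj₂
      · rw [e₂ hj₁ hj₂]
        have e : orient (AffineMap.lineMap A B (a i)) (AffineMap.lineMap A B (a k))
            (AffineMap.lineMap B C (b (j - r))) = (a k - a i) * b (j - r) * orient A B C := by
          simp [orient, AffineMap.lineMap_apply]; ring
        rw [e]
        rcases hj₁.eq_or_lt with rfl | hj₁
        · exact of_zero (by simp [hb.1]) (by unfold OnOneSide; omega)
        · have h₁ := pos hb (m := j - r) (by omega) (by omega)
          have h₂ := sub_pos.2 hak
          exact of_pos (by positivity) (by unfold OnOneSide; omega)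
      · rw [e₃ hj₂]
        have e : orient (AffineMap.lineMap A B (a i)) (AffineMap.lineMap A B (a k))
            (AffineMap.lineMap C A (c (j - 2 * r))) =
              (a k - a i) * (1 - c (j - 2 * r)) * orient A B C := by
          simp [orient, AffineMap.lineMap_apply]; ring
        rw [e]
        have h₁ := sub_pos.2 (param hc (m := j - 2 * r) (by omega)).2
        have h₂ := sub_pos.2 hak
        exact of_pos (by positivity) (by unfold OnOneSide; omega)
    rcases lt_or_ge k (2 * r) with hk₂ | hk₂
    · rw [e₂ hk hk₂]
      rcases lt_or_ge j (2 * r) with hj₂ | hj₂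
      · rw [e₂ (by omega) hj₂]
        have e : orient (AffineMap.lineMap A B (a i)) (AffineMap.lineMap B C (b (k - r)))
            (AffineMap.lineMap B C (b (j - r))) =
              (1 - a i) * (b (j - r) - b (k - r)) * orient A B C := by
          simp [orient, AffineMap.lineMap_apply]; ring
        rw [e]
        have h₁ := sub_pos.2 hai.2
        have h₂ := sub_pos.2 (mono hb (by omega : k - r < j - r) (by omega))
        exact of_pos (by positivity) (by unfold OnOneSide; omega)
      · rw [e₃ hj₂]
        have e : orient (AffineMap.lineMap A B (a i)) (AffineMap.lineMap B C (b (k - r)))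
            (AffineMap.lineMap C A (c (j - 2 * r))) =
              ((1 - a i) * (1 - b (k - r)) * (1 - c (j - 2 * r)) +
                a i * b (k - r) * c (j - 2 * r)) * orient A B C := by
          simp [orient, AffineMap.lineMap_apply]; ring
        rw [e]
        have hbk := param hb (m := k - r) (by omega)
        have hcj := param hc (m := j - 2 * r) (by omega)
        have h₁ := sub_pos.2 hai.2
        have h₂ := sub_pos.2 hbk.2
        have h₃ := sub_pos.2 hcj.2
        have h₄ := hai.1
        have h₅ := hbk.1
        have h₆ := hcj.1
        exact of_pos (by positivity) (by unfold OnOneSide; omega)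
    · rw [e₃ hk₂, e₃ (by omega)]
      have e : orient (AffineMap.lineMap A B (a i)) (AffineMap.lineMap C A (c (k - 2 * r)))
          (AffineMap.lineMap C A (c (j - 2 * r))) =
            a i * (c (j - 2 * r) - c (k - 2 * r)) * orient A B C := by
        simp [orient, AffineMap.lineMap_apply]; ring
      rw [e]
      rcases i.eq_zero_or_pos with rfl | hi₀
      · exact of_zero (by simp [ha.1]) (by unfold OnOneSide; omega)
      · have h₁ := pos ha hi₀ hi
        have h₂ := sub_pos.2 (mono hc (by omega : k - 2 * r < j - 2 * r) (by omega))
        exact of_pos (by positivity) (by unfold OnOneSide; omega)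
  rcases lt_or_ge i (2 * r) with hi₂ | hi₂
  · rw [e₂ hi hi₂]
    rcases lt_or_ge k (2 * r) with hk₂ | hk₂
    · rw [e₂ (by omega) hk₂]
      rcases lt_or_ge j (2 * r) with hj₂ | hj₂
      · rw [e₂ (by omega) hj₂]
        exact of_zero (orient_lineMap_lineMap_lineMap _ _ _ _ _) (by unfold OnOneSide; omega)
      · rw [e₃ hj₂]
        have e : orient (AffineMap.lineMap B C (b (i - r))) (AffineMap.lineMap B C (b (k - r)))
            (AffineMap.lineMap C A (c (j - 2 * r))) =
              (b (k - r) - b (i - r)) * c (j - 2 * r) * orient A B C := by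
          simp [orient, AffineMap.lineMap_apply]; ring
        rw [e]
        rcases hj₂.eq_or_lt with rfl | hj₂
        · exact of_zero (by simp [hc.1]) (by unfold OnOneSide; omega)
        · have h₁ := pos hc (m := j - 2 * r) (by omega) (by omega)
          have h₂ := sub_pos.2 (mono hb (by omega : i - r < k - r) (by omega))
          exact of_pos (by positivity) (by unfold OnOneSide; omega)
    · rw [e₃ hk₂, e₃ (by omega)]
      have e : orient (AffineMap.lineMap B C (b (i - r))) (AffineMap.lineMap C A (c (k - 2 * r)))
          (AffineMap.lineMap C A (c (j - 2 * r))) =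
            (1 - b (i - r)) * (c (j - 2 * r) - c (k - 2 * r)) * orient A B C := by
        simp [orient, AffineMap.lineMap_apply]; ring
      rw [e]
      have h₁ := sub_pos.2 (param hb (m := i - r) (by omega)).2
      have h₂ := sub_pos.2 (mono hc (by omega : k - 2 * r < j - 2 * r) (by omega))
      exact of_pos (by positivity) (by unfold OnOneSide; omega)
  · rw [e₃ hi₂, e₃ (by omega), e₃ (by omega)]
    exact of_zero (orient_lineMap_lineMap_lineMap _ _ _ _ _) (by unfold OnOneSide; omega)

lemma weaklyConvex_trianglePoint (hr : 1 ≤ r) (hΔ : 0 < orient A B C)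
    (ha : a 0 = 0 ∧ a r = 1 ∧ StrictMonoOn a (Set.Iic r))
    (hb : b 0 = 0 ∧ b r = 1 ∧ StrictMonoOn b (Set.Iic r))
    (hc : c 0 = 0 ∧ c r = 1 ∧ StrictMonoOn c (Set.Iic r)) :
    WeaklyConvex (trianglePoint A B C a b c r) (3 * r - 1) where
  nonneg hik hkj hj := (orient_trianglePoint hΔ ha hb hc hik hkj (by omega)).1
  ne {i j} hij hj heq := by
    have key : ∀ {x y z}, x < y → y < z → z < 3 * r → ¬ OnOneSide r x y z →
        0 < orient (trianglePoint A B C a b c r x) (trianglePoint A B C a b c r y)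
          (trianglePoint A B C a b c r z) := fun h h' h'' h₀ =>
      (orient_trianglePoint hΔ ha hb hc h h' h'').2.2 h₀
    -- A corner off the side containing the two points suffices: if the points coincided, its
    -- orientation with them would vanish.
    have h : ∃ m, m < 3 * r ∧ ((m < i ∧ ¬ OnOneSide r m i j) ∨
        (i < m ∧ m < j ∧ ¬ OnOneSide r i m j) ∨ (j < m ∧ ¬ OnOneSide r i j m)) := by
      unfold OnOneSide
      by_cases h₁ : j ≤ r
      · exact ⟨2 * r, by omega, by omega⟩
      by_cases h₂ : i = 0 ∨ 2 * r ≤ i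
      · exact ⟨r, by omega, by omega⟩
      by_cases h₃ : r ≤ i
      · exact ⟨0, by omega, by omega⟩
      by_cases h₄ : 2 * r < j
      · exact ⟨r, by omega, by omega⟩
      · by_cases h₅ : j = 2 * r
        · exact ⟨r, by omega, by omega⟩
        · exact ⟨2 * r, by omega, by omega⟩
    obtain ⟨m, hm, ⟨h, h'⟩ | ⟨h, h', h''⟩ | ⟨h, h'⟩⟩ := h
    · have := key h hij (by omega) h'
      rw [heq] at this; simp at this
    · have := key h h' (by omega) h''
      rw [heq] at this; simp at this
    · have := key hij h hm h'
      rw [heq] at this; simp at this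

/-- The counting problem for a subdivided triangle as a recursion of Catalan type. -/
lemma exists_recursion_of_isSubdividedPolygon {S : Finset Plane} (hr : 1 ≤ r)
    (hS : IsSubdividedPolygon 3 r S) :
    ∃ t : ℕ → ℕ → ℕ, numTriangulations S = t 0 (3 * r - 1) ∧ (∀ i, t i (i + 1) = 1) ∧
      ∀ i j, i + 2 ≤ j → j < 3 * r → t i j = ∑ k ∈ (Finset.Ioo i j).filter
        (fun k => ¬ (j ≤ r ∨ (r ≤ i ∧ j ≤ 2 * r) ∨ 2 * r ≤ i ∨ (i = 0 ∧ 2 * r ≤ k))),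
          t i k * t k j := by
  obtain ⟨-, V, s, hV, hs, hSV⟩ := hS
  have hΔ : 0 < orient (V 0) (V 1) (V 2) := by
    have := hV 0 2 (by decide) (by decide)
    rwa [zero_add] at this
  have hp := weaklyConvex_trianglePoint hr hΔ (hs 0) (hs 1) (hs 2)
  have hpos := @orient_trianglePoint _ _ _ _ _ _ _ hΔ (hs 0) (hs 1) (hs 2)
  set p := trianglePoint (V 0) (V 1) (V 2) (s 0) (s 1) (s 2) r with hpdef
  have hchain : S = chain p 0 (3 * r - 1) := by
    rw [← Finset.coe_inj, hSV]
    ext x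
    simp only [Set.mem_ofPred_eq, Finset.mem_coe, mem_chain]
    have h01 : (0 : ZMod 3) + 1 = 1 := by decide
    have h12 : (1 : ZMod 3) + 1 = 2 := by decide
    have h20 : (2 : ZMod 3) + 1 = 0 := by decide
    constructor
    · rintro ⟨i, j, hj, rfl⟩
      have hi : i = 0 ∨ i = 1 ∨ i = 2 := by revert i; decide
      rcases hi with rfl | rfl | rfl
      · exact ⟨j, by omega, by omega, by rw [hpdef, trianglePoint, if_pos hj, h01]⟩
      · refine ⟨r + j, by omega, by omega, ?_⟩
        rw [hpdef, trianglePoint, if_neg (by omega), if_pos (by omega), h12,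
          Nat.add_sub_cancel_left]
      · refine ⟨2 * r + j, by omega, by omega, ?_⟩
        rw [hpdef, trianglePoint, if_neg (by omega), if_neg (by omega), h20,
          Nat.add_sub_cancel_left]
    · rintro ⟨m, -, hm, rfl⟩
      rw [hpdef, trianglePoint]
      split_ifs with h₁ h₂
      · exact ⟨0, m, h₁, by rw [h01]⟩
      · exact ⟨1, m - r, by omega, by rw [h12]⟩
      · exact ⟨2, m - 2 * r, by omega, by rw [h20]⟩
  refine ⟨fun i j => (chainTriangulations p i j).card, ?_, fun i =>
    WeaklyConvex.card_chainTriangulations_edge, ?_⟩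
  · simp only
    rw [numTriangulations, hchain, ← Set.ncard_coe_finset]
    congr 1
    ext T
    rw [Finset.mem_coe, mem_chainTriangulations (by omega)]
    rfl
  · intro i j hij hj
    simp only
    rw [hp.card_chainTriangulations hij (by omega)]
    refine Finset.sum_congr ?_ fun _ _ => rfl
    ext k
    simp only [Finset.mem_filter, Finset.mem_Ioo, and_congr_right_iff]
    intro hk
    exact (hpos hk.1 hk.2 hj).2

end SubdividedTriangle

/-! ### Solving the recursion -/

section Recursion

/-- If, in a recursion of Catalan type, chords within the two sides of a corner are not allowed,
the number of solutions is a binomial coefficient. -/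
lemma eq_choose_of_recursion {t : ℕ → ℕ → ℕ} {b lo hi : ℕ} (h₁ : ∀ i, t i (i + 1) = 1)
    (hl : ∀ i j, lo ≤ i → i + 2 ≤ j → j ≤ b → t i j = 0)
    (hr : ∀ i j, b ≤ i → i + 2 ≤ j → j ≤ hi → t i j = 0)
    (hrec : ∀ i j, lo ≤ i → i < b → b < j → j ≤ hi →
      t i j = ∑ k ∈ Finset.Ioo i j, t i k * t k j) (x y : ℕ) (hx : lo + (x + 1) ≤ b)
    (hy : b + (y + 1) ≤ hi) : t (b - (x + 1)) (b + (y + 1)) = (x + y).choose x := by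
  induction hN : x + y generalizing x y with
  | zero =>
    obtain ⟨rfl, rfl⟩ : x = 0 ∧ y = 0 := by omega
    rw [hrec _ _ (by omega) (by omega) (by omega) hy]
    obtain ⟨b, rfl⟩ : ∃ b', b = b' + 1 := ⟨b - 1, by omega⟩
    have : Finset.Ioo (b + 1 - (0 + 1)) (b + 1 + (0 + 1)) = {b + 1} := by
      ext k; simp only [Finset.mem_Ioo, Finset.mem_singleton]; omega
    rw [this, Finset.sum_singleton]
    simp [h₁]
  | succ N ih =>
    rw [hrec _ _ (by omega) (by omega) (by omega) hy]
    -- Any apex other than the neighbours of the two ends leaves a chain of at least two edges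
    -- inside one side, which contributes zero. What remains is Pascal's rule.
    have hsub : ({b - x, b + y} : Finset ℕ) ⊆ Finset.Ioo (b - (x + 1)) (b + (y + 1)) := by
      intro k hk
      simp only [Finset.mem_insert, Finset.mem_singleton, Finset.mem_Ioo] at hk ⊢
      omega
    rw [← Finset.sum_subset hsub, Finset.sum_pair (by omega)]
    · have e₁ : t (b - (x + 1)) (b - x) = 1 := by
        have := h₁ (b - (x + 1))
        rwa [show b - (x + 1) + 1 = b - x by omega] at this
      have e₂ : t (b + y) (b + (y + 1)) = 1 := h₁ (b + y)
      rw [e₁, e₂, one_mul, mul_one]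
      rcases x with _ | x <;> rcases y with _ | y
      · omega
      · rw [hr _ _ (by omega) (by omega) (by omega), ih 0 y hx (by omega) (by omega)]
        simp
      · rw [hl (b - (x + 1 + 1)) _ (by omega) (by omega) (by omega), ih x 0 (by omega) hy (by omega)]
        obtain rfl : x = N := by omega
        simp
      · rw [ih x (y + 1) (by omega) hy (by omega), ih (x + 1) y hx (by omega) (by omega),
          Nat.choose_succ_succ]
    · intro k hk hk'
      simp only [Finset.mem_insert, Finset.mem_singleton, Finset.mem_Ioo] at hk hk'
      rcases le_total k b with h | h
      · rw [hl _ k (by omega) (by omega) h, zero_mul]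
      · rw [hr k _ h (by omega) hy, mul_zero]

/-- Compare coefficients in the product of the powers `x + 1` and `y + 1` of the geometric series.
-/
lemma sum_range_choose_mul_choose (x y n : ℕ) :
    ∑ m ∈ Finset.range (n + 1), (x + m).choose x * (y + (n - m)).choose y =
      (x + y + 1 + n).choose n := by
  have h := congrArg (PowerSeries.coeff n) (pow_add 
    (PowerSeries.mk 1 : PowerSeries ℤ) (x + 1) (y + 1))
  rw [show x + 1 + (y + 1) = x + y + 1 + 1 by ring, PowerSeries.mk_one_pow_eq_mk_choose_add,
    PowerSeries.mk_one_pow_eq_mk_choose_add, PowerSeries.mk_one_pow_eq_mk_choose_add,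
    PowerSeries.coeff_mul, Finset.Nat.sum_antidiagonal_eq_sum_range_succ_mk] at h
  simp only [PowerSeries.coeff_mk] at h
  rw [← Nat.choose_symm_add]
  exact_mod_cast h.symm

/-- Partial row sums of Pascal's triangle. -/
def chooseSum (n m : ℕ) : ℤ := ∑ j ∈ Finset.range m, (n.choose j : ℤ)

lemma chooseSum_succ_right (n m : ℕ) : chooseSum n (m + 1) = chooseSum n m + n.choose m :=
  Finset.sum_range_succ _ _

@[simp] lemma chooseSum_zero (n : ℕ) : chooseSum n 0 = 0 := rfl

lemma chooseSum_succ_left (n m : ℕ) :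
    chooseSum (n + 1) m = chooseSum n m + chooseSum n (m - 1) := by
  induction m with
  | zero => simp
  | succ m ih =>
    rcases m with _ | m
    · simp [chooseSum]
    · rw [chooseSum_succ_right, ih, chooseSum_succ_right n (m + 1), Nat.choose_succ_succ]
      simp only [Nat.add_sub_cancel]
      rw [chooseSum_succ_right n m]
      push_cast; ring

/-- Row `x + y` of Pascal's triangle is split at position `x`, and its upper part is reflected. This
supplies the boundary values for `quad` below. -/
lemma two_pow_eq_chooseSum_add (x y : ℕ) :
    (2 : ℤ) ^ (x + y) = chooseSum (x + y) x + (x + y).choose x + chooseSum (x + y) y := by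
  have h := Nat.sum_range_choose (x + y)
  rw [show x + y + 1 = (x + 1) + y by ring, Finset.sum_range_add, Finset.sum_range_succ,
    ← Finset.sum_range_reflect (n := y)] at h
  rw [← chooseSum_succ_right]
  have e : ∑ j ∈ Finset.range y, (x + y).choose (x + 1 + (y - 1 - j)) =
      ∑ j ∈ Finset.range y, (x + y).choose j := by
    refine Finset.sum_congr rfl fun j hj => ?_
    rw [Finset.mem_range] at hj
    exact Nat.choose_symm_of_eq_add (by omega)
  rw [e] at h
  simp only [chooseSum, Finset.sum_range_succ]
  exact_mod_cast h.symm

/-- The solution of the recursion for a triangle with subdivided sides. -/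
theorem eq_two_pow_sub_of_recursion {t : ℕ → ℕ → ℕ} {r : ℕ} (hr : 2 ≤ r)
    (h₁ : ∀ i, t i (i + 1) = 1)
    (hrec : ∀ i j, i + 2 ≤ j → j < 3 * r → t i j = ∑ k ∈ (Finset.Ioo i j).filter
        (fun k => ¬ (j ≤ r ∨ (r ≤ i ∧ j ≤ 2 * r) ∨ 2 * r ≤ i ∨ (i = 0 ∧ 2 * r ≤ k))),
          t i k * t k j) :
    (t 0 (3 * r - 1) : ℤ) =
      2 ^ (3 * r - 4) - 3 * ∑ j ∈ Finset.range (r - 2), ((3 * r - 4).choose j : ℤ) := by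
  have hzero : ∀ i j, i + 2 ≤ j → j < 3 * r → (j ≤ r ∨ (r ≤ i ∧ j ≤ 2 * r) ∨ 2 * r ≤ i) →
      t i j = 0 := by
    intro i j hij hj h
    rw [hrec i j hij hj, Finset.filter_false_of_mem, Finset.sum_empty]
    intro k hk
    omega
  have hfull : ∀ i j, i + 2 ≤ j → j < 3 * r → r < j → i < 2 * r → (i < r ∨ 2 * r < j) →
      (0 < i ∨ j ≤ 2 * r) → t i j = ∑ k ∈ Finset.Ioo i j, t i k * t k j := by
    intro i j hij hj h₁ h₂ h₃ h₄
    rw [hrec i j hij hj, Finset.filter_true_of_mem]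
    intro k hk
    rw [Finset.mem_Ioo] at hk
    omega
  have corner₁ : ∀ x y, x + 1 ≤ r → y + 1 ≤ r →
      t (r - (x + 1)) (r + (y + 1)) = (x + y).choose x := fun x y hx hy =>
    eq_choose_of_recursion (lo := 0) (hi := 2 * r) h₁
      (fun i j _ hij hj => hzero i j hij (by omega) (by omega))
      (fun i j _ hij hj => hzero i j hij (by omega) (by omega))
      (fun i j _ hi hj hj' => hfull i j (by omega) (by omega) (by omega) (by omega) (by omega)
        (by omega)) x y (by omega) (by omega)
  have corner₂ : ∀ x y, x + 1 ≤ r → y + 2 ≤ r →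
      t (2 * r - (x + 1)) (2 * r + (y + 1)) = (x + y).choose x := fun x y hx hy =>
    eq_choose_of_recursion (lo := r) (hi := 3 * r - 1) h₁
      (fun i j _ hij hj => hzero i j hij (by omega) (by omega))
      (fun i j _ hij hj => hzero i j hij (by omega) (by omega))
      (fun i j _ hi hj hj' => hfull i j (by omega) (by omega) (by omega) (by omega) (by omega)
        (by omega)) x y (by omega) (by omega)
  -- The contribution of the apexes inside the second side: each splits off one count at either end
  -- of that side.
  have middle : ∀ x y, x + 1 ≤ r → y + 2 ≤ r →
      ∑ k ∈ Finset.Ico (r + 1) (2 * r), t (r - (x + 1)) k * t k (2 * r + (y + 1)) =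
        (x + y + 1 + (r - 2)).choose (r - 2) := by
    intro x y hx hy
    rw [Finset.sum_Ico_eq_sum_range, ← sum_range_choose_mul_choose,
      show 2 * r - (r + 1) = r - 2 + 1 by omega]
    refine Finset.sum_congr rfl fun m hm => ?_
    rw [Finset.mem_range] at hm
    rw [add_assoc r 1 m, add_comm 1 m, corner₁ x m hx (by omega),
      show r + (m + 1) = 2 * r - ((r - 2 - m) + 1) by omega, corner₂ _ y (by omega) hy,
      add_comm (r - 2 - m) y, Nat.choose_symm_add, Nat.choose_symm_add]
  -- Chains with `x` edges on the first side, the whole second side and `y` edges on the third. For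
  -- `x = 0` or `y = 0` they surround one corner only, and the truncated `x - 1` or `y - 1` makes
  -- the corresponding partial sum empty.
  have quad : ∀ N x y, x + y = N → 1 ≤ N → x + 1 ≤ r → y + 1 ≤ r → (t (r - x) (2 * r + y) : ℤ) =
      2 ^ (x + y + (r - 2)) - chooseSum (x + y + (r - 2)) (x - 1) -
        chooseSum (x + y + (r - 2)) (y - 1) - chooseSum (x + y + (r - 2)) (r - 1) := by
    intro N
    induction N with
    | zero => omega
    | succ N ih =>
      intro x y hN _ hx hy
      rcases x with _ | x
      · obtain rfl : y = N + 1 := by omega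
        have h := corner₂ (r - 1) N (by omega) (by omega)
        have h2 := two_pow_eq_chooseSum_add (r - 1) N
        rw [show 2 * r - (r - 1 + 1) = r - 0 by omega] at h
        rw [h, show 0 + (N + 1) + (r - 2) = r - 1 + N by omega, h2]
        simp
      rcases y with _ | y
      · have h := corner₁ x (r - 1) (by omega) (by omega)
        have h2 := two_pow_eq_chooseSum_add x (r - 1)
        rw [show r + (r - 1 + 1) = 2 * r + 0 by omega] at h
        rw [h, show x + 1 + 0 + (r - 2) = x + (r - 1) by omega, h2]
        simp; ring
      rw [hfull _ _ (by omega) (by omega) (by omega) (by omega) (by omega) (by omega)]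
      have hIoo : Finset.Ioo (r - (x + 1)) (2 * r + (y + 1)) =
          Finset.Ico (r - x) (2 * r + (y + 1)) := by
        ext k; simp only [Finset.mem_Ioo, Finset.mem_Ico]; omega
      rw [hIoo, ← Finset.sum_Ico_consecutive _ (by omega : r - x ≤ r + 1)
        (by omega : r + 1 ≤ 2 * r + (y + 1)), ← Finset.sum_Ico_consecutive _
        (by omega : r + 1 ≤ 2 * r) (by omega : 2 * r ≤ 2 * r + (y + 1)),
        middle x y (by omega) (by omega), Finset.sum_eq_single_of_mem (r - x)
        (by rw [Finset.mem_Ico]; omega), Finset.sum_eq_single_of_mem (2 * r + y)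
        (by rw [Finset.mem_Ico]; omega)]
      · have e₁ : t (r - (x + 1)) (r - x) = 1 := by
          have := h₁ (r - (x + 1))
          rwa [show r - (x + 1) + 1 = r - x by omega] at this
        have e₂ : t (2 * r + y) (2 * r + (y + 1)) = 1 := h₁ _
        rw [e₁, e₂]
        push_cast
        rw [ih x (y + 1) (by omega) (by omega) (by omega) (by omega),
          ih (x + 1) y (by omega) (by omega) (by omega) (by omega)]
        rw [show x + (y + 1) + (r - 2) = x + y + 1 + (r - 2) by ring,
          show x + 1 + y + (r - 2) = x + y + 1 + (r - 2) by ring,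
          show x + 1 + (y + 1) + (r - 2) = x + y + 1 + (r - 2) + 1 by ring,
          chooseSum_succ_left, chooseSum_succ_left, chooseSum_succ_left, pow_succ,
          show r - 1 = r - 2 + 1 by omega, chooseSum_succ_right]
        simp only [Nat.add_sub_cancel]
        ring
      · intro k hk hk'
        rw [Finset.mem_Ico] at hk
        rw [hzero k _ (by omega) (by omega) (by omega), mul_zero]
      · intro k hk hk'
        rw [Finset.mem_Ico] at hk
        rw [hzero _ k (by omega) (by omega) (by omega), zero_mul]
  -- The base of the full configuration lies on the third side, so apexes from `2 * r` on are
  -- excluded. Of the others, only 1 and those inside the second side contribute; the latter cancel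
  -- the extra binomial coefficient in `hquad`.
  have hIoo : (Finset.Ioo 0 (3 * r - 1)).filter (fun k => ¬ (3 * r - 1 ≤ r ∨
      (r ≤ 0 ∧ 3 * r - 1 ≤ 2 * r) ∨ 2 * r ≤ 0 ∨ (0 = 0 ∧ 2 * r ≤ k))) = Finset.Ico 1 (2 * r) := by
    ext k; rw [Finset.mem_filter, Finset.mem_Ioo, Finset.mem_Ico]; omega
  have hmid := middle (r - 1) (r - 2) (by omega) (by omega)
  rw [show r - (r - 1 + 1) = 0 by omega, show 2 * r + (r - 2 + 1) = 3 * r - 1 by omega,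
    show r - 1 + (r - 2) + 1 + (r - 2) = 3 * r - 4 by omega] at hmid
  have hquad := quad _ (r - 1) (r - 1) rfl (by omega) (by omega) (by omega)
  rw [show r - (r - 1) = 1 by omega, show 2 * r + (r - 1) = 3 * r - 1 by omega,
    show r - 1 + (r - 1) + (r - 2) = 3 * r - 4 by omega, show r - 1 = r - 2 + 1 by omega,
    chooseSum_succ_right, Nat.add_sub_cancel] at hquad
  rw [hrec 0 _ (by omega) (by omega), hIoo, ← Finset.sum_Ico_consecutive _
    (by omega : 1 ≤ r + 1) (by omega : r + 1 ≤ 2 * r), hmid,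
    Finset.sum_eq_single_of_mem 1 (by rw [Finset.mem_Ico]; omega), h₁ 0, one_mul]
  · push_cast
    rw [hquad]
    simp only [chooseSum]
    ring
  · intro k hk hk'
    rw [Finset.mem_Ico] at hk
    rw [hzero _ k (by omega) (by omega) (by omega), zero_mul]

end Recursion

/-! ### The cubic series and ternary binomial series -/

section Series

open PowerSeries

lemma constantCoeff_eq_zero_of_cubic {g : PowerSeries ℚ} (hg : g * (1 - g) ^ 2 = X) :
    constantCoeff g = 0 := by
  have h := congrArg constantCoeff hg
  simp only [map_mul, map_pow, map_sub, map_one, constantCoeff_X] at h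
  rcases mul_eq_zero.1 h with h | h
  · exact h
  -- Constant term 1 is impossible: then `1 - g` is divisible by `X`, and the left side of the
  -- equation by `X ^ 2`.
  · exfalso
    have h0 : constantCoeff (1 - g) = 0 := by
      simpa using pow_eq_zero_iff (two_ne_zero) |>.1 h
    obtain ⟨k, hk⟩ := X_dvd_iff.2 h0
    have h1 : X * (g * X * k ^ 2) = X * (1 : PowerSeries ℚ) := by
      rw [mul_one]; nth_rewrite 3 [← hg]; rw [hk]; ring
    have h2 := congrArg constantCoeff (mul_left_cancel₀ X_ne_zero h1)
    simp at h2

lemma cubic_unique {g h : PowerSeries ℚ} (hg : g * (1 - g) ^ 2 = X) (hh : h * (1 - h) ^ 2 = X) :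
    g = h := by
  have e : (g - h) * (1 - 2 * (g + h) + (g ^ 2 + g * h + h ^ 2)) = 0 := by
    linear_combination hg - hh
  rcases mul_eq_zero.1 e with e | e
  · exact sub_eq_zero.1 e
  · have := congrArg constantCoeff e
    simp [constantCoeff_eq_zero_of_cubic hg, constantCoeff_eq_zero_of_cubic hh] at this

/-- Approximations of the solution of `g * (1 - g) ^ 2 = X`. -/
noncomputable def cubicApprox : ℕ → PowerSeries ℚ
  | 0 => 0
  | n + 1 => X + 2 * cubicApprox n ^ 2 - cubicApprox n ^ 3

lemma X_dvd_cubicApprox (n : ℕ) : X ∣ cubicApprox n := by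
  cases n with
  | zero => exact dvd_zero _
  | succ n =>
    induction n with
    | zero => simp [cubicApprox]
    | succ n ih =>
      obtain ⟨k, hk⟩ := ih
      rw [cubicApprox, hk]
      exact ⟨1 + 2 * X * k ^ 2 - X ^ 2 * k ^ 3, by ring⟩

/-- The cubic equation is the fixed point equation of this map, which is an `X`-adic contraction on
series without constant term. -/
lemma cubicStep_sub_dvd {g h : PowerSeries ℚ} (hg : X ∣ g) (hh : X ∣ h) {n : ℕ}
    (hgh : X ^ n ∣ g - h) : X ^ (n + 1) ∣ (X + 2 * g ^ 2 - g ^ 3) - (X + 2 * h ^ 2 - h ^ 3) := by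
  obtain ⟨a, rfl⟩ := hg
  obtain ⟨b, rfl⟩ := hh
  obtain ⟨k, hk⟩ := hgh
  exact ⟨k * (2 * (a + b) - X * (a ^ 2 + a * b + b ^ 2)), by
    linear_combination (2 * (X * a + X * b) - ((X * a) ^ 2 + X * a * (X * b) + (X * b) ^ 2)) * hk⟩

lemma cubicApprox_succ_sub_dvd (n : ℕ) : X ^ n ∣ cubicApprox (n + 1) - cubicApprox n := by
  induction n with
  | zero => simp
  | succ n ih =>
    exact cubicStep_sub_dvd (X_dvd_cubicApprox _) (X_dvd_cubicApprox _) ih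

lemma exists_cubic : ∃ g : PowerSeries ℚ, g * (1 - g) ^ 2 = X := by
  obtain ⟨g, hg⟩ : ∃ g : PowerSeries ℚ, g = mk fun n => coeff n (cubicApprox (n + 1)) := ⟨_, rfl⟩
  have hstable : ∀ m n, m < n → coeff m (cubicApprox n) = coeff m g := by
    intro m n hmn
    induction n, hmn using Nat.le_induction with
    | base => rw [hg, coeff_mk]
    | succ n hmn ih =>
      rw [← ih, ← sub_eq_zero, ← map_sub]
      exact X_pow_dvd_iff.1 (cubicApprox_succ_sub_dvd n) m hmn
  have happrox : ∀ n, X ^ n ∣ g - cubicApprox n := fun n =>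
    X_pow_dvd_iff.2 fun m hm => by rw [map_sub, hstable m n hm, sub_self]
  have hX : X ∣ g := by
    have := happrox 1
    rw [pow_one] at this
    exact (dvd_sub_left (X_dvd_cubicApprox 1)).1 this
  refine ⟨g, ?_⟩
  have hfix : X + 2 * g ^ 2 - g ^ 3 = g := by
    ext n
    have h := X_pow_dvd_iff.1 (cubicStep_sub_dvd hX (X_dvd_cubicApprox n) (happrox n)) n (by omega)
    rw [map_sub, sub_eq_zero] at h
    rw [h, ← hstable n (n + 1) (by omega), cubicApprox]
  linear_combination -hfix

/-- The generating function of the binomial coefficients `(3 n + a).choose n`. -/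
noncomputable def ternarySeries (a : ℕ) : PowerSeries ℚ := mk fun n => ((3 * n + a).choose n : ℚ)

lemma ternarySeries_succ (a : ℕ) :
    ternarySeries (a + 1) = ternarySeries a + X * ternarySeries (a + 3) := by
  ext n
  cases n with
  | zero => simp [ternarySeries]
  | succ n =>
    rw [map_add, coeff_succ_X_mul]
    simp only [ternarySeries, coeff_mk]
    rw [show 3 * (n + 1) + (a + 1) = 3 * n + (a + 3) + 1 by ring, Nat.choose_succ_succ,
      show 3 * (n + 1) + a = 3 * n + (a + 3) by ring]
    push_cast; ring

lemma ternarySeries_zero : ternarySeries 0 = 1 + 3 * (X * ternarySeries 2) := by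
  ext n
  cases n with
  | zero => simp [ternarySeries]
  | succ n =>
    rw [show (3 : PowerSeries ℚ) = C 3 from (map_ofNat C 3).symm, map_add, coeff_C_mul, coeff_succ_X_mul]
    simp only [ternarySeries, coeff_mk, coeff_one]
    have h := Nat.add_one_mul_choose_eq (3 * n + 2) n
    have h' : ((3 * n + 2 : ℕ) + 1 : ℚ) * (3 * n + 2).choose n =
        (3 * n + 2 + 1).choose (n + 1) * (n + 1) := by exact_mod_cast h
    have hn : (n + 1 : ℚ) ≠ 0 := by positivity
    rw [show 3 * (n + 1) + 0 = 3 * n + 2 + 1 by ring]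
    simp only [Nat.add_eq_zero_iff, one_ne_zero, and_false, if_false, zero_add]
    apply mul_right_cancel₀ hn
    push_cast at h' ⊢
    linear_combination -h'

/-- With `v = 1 / (1 - g)` and `s = 1 / (1 - 3g)`, the series `s * v ^ a` satisfy the same relations
as in `ternarySeries_succ` and `ternarySeries_zero`. These determine all coefficients, by induction
on the degree and then on `a`. -/
lemma ternarySeries_mul {g : PowerSeries ℚ} (hg : g * (1 - g) ^ 2 = X) (a : ℕ) :
    ternarySeries a * ((1 - 3 * g) * (1 - g) ^ a) = 1 := by
  have h0 := constantCoeff_eq_zero_of_cubic hg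
  obtain ⟨v, hv⟩ : ∃ v, v * (1 - g) = 1 :=
    ⟨(1 - g)⁻¹, PowerSeries.inv_mul_cancel _ (by simp [h0])⟩
  obtain ⟨s, hs⟩ : ∃ s, s * (1 - 3 * g) = 1 :=
    ⟨(1 - 3 * g)⁻¹, PowerSeries.inv_mul_cancel _ (by simp [h0])⟩
  have hsucc : ∀ a, s * v ^ (a + 1) = s * v ^ a + X * (s * v ^ (a + 3)) := by
    intro a
    rw [← hg]
    linear_combination (s * v ^ a - s * g * v ^ (a + 1) * (v * (1 - g) + 1)) * hv
  have hzero : s * v ^ 0 = 1 + 3 * (X * (s * v ^ 2)) := by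
    rw [← hg]
    linear_combination hs - 3 * g * s * (v * (1 - g) + 1) * hv
  have key : ∀ n a, coeff n (ternarySeries a - s * v ^ a) = 0 := by
    intro n
    induction n with
    | zero =>
      intro a
      induction a with
      | zero =>
        rw [ternarySeries_zero, hzero]; simp
      | succ a ih =>
        rw [ternarySeries_succ, hsucc, add_sub_add_comm, map_add, ih, ← mul_sub]; simp
    | succ n ihn =>
      intro a
      induction a with
      | zero =>
        rw [ternarySeries_zero, hzero, add_sub_add_left_eq_sub, ← mul_sub, ← mul_sub,
          show (3 : PowerSeries ℚ) = C 3 from (map_ofNat C 3).symm, coeff_C_mul, coeff_succ_X_mul, ihn, mul_zero]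
      | succ a ih =>
        rw [ternarySeries_succ, hsucc, add_sub_add_comm, map_add, ih, ← mul_sub,
          coeff_succ_X_mul, ihn, zero_add]
  have heq : ternarySeries a = s * v ^ a := sub_eq_zero.1 (by ext n; simpa using key n a)
  rw [heq, show s * v ^ a * ((1 - 3 * g) * (1 - g) ^ a) = s * (1 - 3 * g) * (v * (1 - g)) ^ a by
    rw [mul_pow]; ring, hs, hv]
  simp

/-- For positive `j` the right side is `(3j).choose j + 3 * (3j).choose (j-1)`, and the two binomial
coefficients have ratio `(2j+1) : j`. -/
lemma mul_choose_eq_add (j : ℕ) :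
    (5 * (j : ℚ) + 1) / (2 * (j : ℚ) + 1) * ((3 * j).choose j : ℚ) =
      coeff j (ternarySeries 0 + 3 * (X * ternarySeries 3)) := by
  rw [show (3 : PowerSeries ℚ) = C 3 from (map_ofNat C 3).symm, map_add, coeff_C_mul]
  cases j with
  | zero => simp [ternarySeries]
  | succ j =>
    rw [coeff_succ_X_mul]
    simp only [ternarySeries, coeff_mk, add_zero]
    have h := Nat.choose_succ_right_eq (3 * j + 3) j
    rw [show 3 * j + 3 - j = 2 * j + 3 by omega] at h
    have h' : ((3 * j + 3).choose (j + 1) : ℚ) * (j + 1) = (3 * j + 3).choose j * (2 * j + 3) := by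
      exact_mod_cast h
    rw [show 3 * (j + 1) = 3 * j + 3 by ring]
    have : (2 * ((j + 1 : ℕ) : ℚ) + 1) ≠ 0 := by positivity
    rw [div_mul_eq_mul_div, div_eq_iff this]
    push_cast
    linear_combination 3 * h'

/-- The recursion behind the second formula. -/
lemma two_pow_sub_chooseSum_succ (r : ℕ) :
    (((2 : ℤ) ^ (3 * (r + 1) + 2) - 3 * chooseSum (3 * (r + 1) + 2) (r + 2) : ℤ) : ℚ) =
      8 * ((2 ^ (3 * r + 2) - 3 * chooseSum (3 * r + 2) (r + 1) : ℤ) : ℚ) +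
        coeff (r + 1) (ternarySeries 0 + 3 * (X * ternarySeries 3)) := by
  -- Passing to the next row doubles a partial sum up to a boundary term; three rows give the factor
  -- 8.
  have hrow : ∀ n m, chooseSum (n + 1) (m + 1) = 2 * chooseSum n (m + 1) - n.choose m := by
    intro n m
    rw [chooseSum_succ_left, Nat.add_sub_cancel, chooseSum_succ_right]; ring
  rw [show (3 : PowerSeries ℚ) = C 3 from (map_ofNat C 3).symm, map_add, coeff_C_mul, coeff_succ_X_mul]
  simp only [ternarySeries, coeff_mk, add_zero]
  have h := Nat.choose_succ_right_eq (3 * r + 2) r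
  rw [show 3 * r + 2 - r = 2 * (r + 1) by omega, ← mul_assoc] at h
  have h' : (3 * r + 2).choose (r + 1) = (3 * r + 2).choose r * 2 :=
    Nat.eq_of_mul_eq_mul_right (Nat.succ_pos r) h
  rw [show 3 * (r + 1) + 2 = 3 * r + 2 + 1 + 1 + 1 by ring, hrow, hrow, hrow,
    chooseSum_succ_right, show 3 * (r + 1) = 3 * r + 2 + 1 by ring,
    show 3 * r + 3 = 3 * r + 2 + 1 by ring, Nat.choose_succ_succ (3 * r + 2 + 1),
    Nat.choose_succ_succ (3 * r + 2) r, h']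
  push_cast
  ring

end Series

/-! ### The three formulas -/

section Conclusion

open PowerSeries

lemma numTriangulations_of_two_le {S : Finset Plane} {r : ℕ} (hr : 2 ≤ r)
    (hS : IsSubdividedPolygon 3 r S) : (numTriangulations S : ℤ) =
      2 ^ (3 * r - 4) - 3 * ∑ j ∈ Finset.range (r - 2), ((3 * r - 4).choose j : ℤ) := by
  obtain ⟨t, ht, h₁, hrec⟩ := exists_recursion_of_isSubdividedPolygon (by omega) hS
  rw [ht]
  exact eq_two_pow_sub_of_recursion hr h₁ hrec

lemma numTriangulations_of_eq_one {S : Finset Plane} (hS : IsSubdividedPolygon 3 1 S) :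
    numTriangulations S = 1 := by
  obtain ⟨t, ht, h₁, hrec⟩ := exists_recursion_of_isSubdividedPolygon le_rfl hS
  have hIoo : (Finset.Ioo 0 2).filter (fun k => ¬ (2 ≤ 1 ∨ (1 ≤ 0 ∧ 2 ≤ 2 * 1) ∨ 2 * 1 ≤ 0 ∨
      (0 = 0 ∧ 2 * 1 ≤ k))) = {1} := by decide
  rw [ht, show 3 * 1 - 1 = 2 from rfl, hrec 0 2 (by omega) (by omega), hIoo,
    Finset.sum_singleton, h₁ 0, h₁ 1]

/-- The correction term of the second formula. -/
lemma two_pow_sub_chooseSum_eq_sum (r : ℕ) :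
    ((2 ^ (3 * r + 2) - 3 * chooseSum (3 * r + 2) (r + 1) : ℤ) : ℚ) =
      ∑ j ∈ Finset.range (r + 1),
        (5 * (j : ℚ) + 1) / (2 * (j : ℚ) + 1) * ((3 * j).choose j : ℚ) * 8 ^ (r - j) := by
  induction r with
  | zero => simp [chooseSum]
  | succ r ih =>
    rw [two_pow_sub_chooseSum_succ, ih, Finset.sum_range_succ _ (r + 1), ← mul_choose_eq_add,
      Nat.sub_self, pow_zero, mul_one, Finset.mul_sum]
    congr 1
    refine Finset.sum_congr rfl fun j hj => ?_
    rw [Finset.mem_range] at hj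
    rw [show r + 1 - j = r - j + 1 by omega, pow_succ]
    ring

theorem mainTheorem10
    (SC : ℕ → Finset Plane) (hSC : ∀ r, 1 ≤ r → IsSubdividedPolygon 3 r (SC r))
    (tr : ℕ → ℕ) (htr : ∀ r, tr r = numTriangulations (SC r)) :
    (∀ r : ℕ, 2 ≤ r →
      (tr r : ℤ) = 2 ^ (3 * r - 4) - 3 * ∑ j ∈ Finset.range (r - 2), ((3 * r - 4).choose j : ℤ)) ∧
    (∀ r : ℕ,
      (tr (r + 2) : ℚ) = 3 * ((3 * r + 2).choose r : ℚ) +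
        ∑ j ∈ Finset.range (r + 1),
          (5 * (j : ℚ) + 1) / (2 * (j : ℚ) + 1) * ((3 * j).choose j : ℚ) * 8 ^ (r - j)) ∧
    (∃! g : PowerSeries ℚ, g * (1 - g) ^ 2 = PowerSeries.X) ∧
    (∀ g : PowerSeries ℚ, g * (1 - g) ^ 2 = PowerSeries.X →
      PowerSeries.constantCoeff ((1 - 3 * g) * (2 * g - 1) * (4 * g ^ 2 - 6 * g + 1)) ≠ 0 ∧
      PowerSeries.mk (fun n => (tr (n + 1) : ℚ)) =
        (10 * g ^ 3 - 17 * g ^ 2 + 7 * g - 1) *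
          ((1 - 3 * g) * (2 * g - 1) * (4 * g ^ 2 - 6 * g + 1))⁻¹) := by
  have part₁ : ∀ r : ℕ, 2 ≤ r → (tr r : ℤ) =
      2 ^ (3 * r - 4) - 3 * ∑ j ∈ Finset.range (r - 2), ((3 * r - 4).choose j : ℤ) := by
    intro r hr
    rw [htr]
    exact numTriangulations_of_two_le hr (hSC r (by omega))
  have hone : tr 1 = 1 := by
    rw [htr]
    exact numTriangulations_of_eq_one (hSC 1 le_rfl)
  have hsplit : ∀ r : ℕ, (tr (r + 2) : ℚ) = 3 * ((3 * r + 2).choose r : ℚ) +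
      ((2 ^ (3 * r + 2) - 3 * chooseSum (3 * r + 2) (r + 1) : ℤ) : ℚ) := by
    intro r
    have h := part₁ (r + 2) (by omega)
    rw [show 3 * (r + 2) - 4 = 3 * r + 2 by omega, Nat.add_sub_cancel] at h
    have h' : (tr (r + 2) : ℤ) = 3 * ((3 * r + 2).choose r : ℤ) +
        (2 ^ (3 * r + 2) - 3 * chooseSum (3 * r + 2) (r + 1)) := by
      rw [h, chooseSum_succ_right, chooseSum]; ring
    exact_mod_cast congrArg (Int.cast (R := ℚ)) h'
  refine ⟨part₁, fun r => ?_, ?_, fun g hg => ?_⟩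
  · rw [hsplit, two_pow_sub_chooseSum_eq_sum]
  · obtain ⟨g, hg⟩ := exists_cubic
    exact ⟨g, hg, fun h hh => cubic_unique hh hg⟩
  · have h0 := constantCoeff_eq_zero_of_cubic hg
    have hne : constantCoeff ((1 - 3 * g) * (2 * g - 1) * (4 * g ^ 2 - 6 * g + 1)) ≠ 0 := by
      simp [h0]
    refine ⟨hne, ?_⟩
    rw [PowerSeries.eq_mul_inv_iff_mul_eq hne]
    obtain ⟨W, hW⟩ : ∃ W : PowerSeries ℚ, W = mk fun r =>
      ((2 ^ (3 * r + 2) - 3 * chooseSum (3 * r + 2) (r + 1) : ℤ) : ℚ) := ⟨_, rfl⟩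
    have hF : mk (fun n => (tr (n + 1) : ℚ)) = 1 + X * (3 * ternarySeries 2 + W) := by
      ext n
      cases n with
      | zero => simp [hone]
      | succ n =>
        rw [map_add, coeff_succ_X_mul, map_add, show (3 : PowerSeries ℚ) = C 3 from
          (map_ofNat C 3).symm, coeff_C_mul, hW, coeff_mk, coeff_mk, hsplit, coeff_one]
        simp [ternarySeries]
    -- The recursion with factor 8 as an identity of generating functions.
    have hWE : W * (1 - 8 * X) = ternarySeries 0 + 3 * (X * ternarySeries 3) := by
      suffices h : W = X * (8 * W) + (ternarySeries 0 + 3 * (X * ternarySeries 3)) by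
        linear_combination h
      ext n
      cases n with
      | zero => simp [hW, ternarySeries, chooseSum]; norm_num
      | succ n =>
        rw [map_add, coeff_succ_X_mul, show (8 : PowerSeries ℚ) = C 8 from
          (map_ofNat C 8).symm, coeff_C_mul, hW, coeff_mk, coeff_mk]
        exact two_pow_sub_chooseSum_succ n
    have m₀ := ternarySeries_mul hg 0
    have m₁ := ternarySeries_mul hg 1
    have m₂ := ternarySeries_mul hg 2
    have hs := ternarySeries_succ 0
    rw [zero_add, zero_add] at hs
    -- This factorization produces the last two factors of the denominator, up to sign; the factor
    -- `1 - 3 * g` comes from the ternary series.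
    have hX : (1 - 8 * X : PowerSeries ℚ) = (1 - 2 * g) * (4 * g ^ 2 - 6 * g + 1) := by
      rw [← hg]; ring
    rw [hF]
    have e₂ : X * ternarySeries 2 * (1 - 3 * g) = g := by
      rw [← hg]; linear_combination g * m₂
    have e₁ : X * ternarySeries 1 * (1 - 3 * g) = g * (1 - g) := by
      rw [← hg]; linear_combination g * (1 - g) * m₁
    have e₀ : ternarySeries 0 * (1 - 3 * g) = 1 := by linear_combination m₀
    have eW : X * W * (1 - 3 * g) * (1 - 8 * X) = -2 * X + 3 * (g * (1 - g)) := by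
      linear_combination X * (1 - 3 * g) * hWE - 3 * X * (1 - 3 * g) * hs + 3 * e₁ - 2 * X * e₀
    rw [show (1 + X * (3 * ternarySeries 2 + W)) *
        ((1 - 3 * g) * (2 * g - 1) * (4 * g ^ 2 - 6 * g + 1)) =
      -((1 - 3 * g) + 3 * (X * ternarySeries 2 * (1 - 3 * g))) *
          ((1 - 2 * g) * (4 * g ^ 2 - 6 * g + 1)) -
        X * W * (1 - 3 * g) * ((1 - 2 * g) * (4 * g ^ 2 - 6 * g + 1)) by ring, e₂, ← hX, eW,
      ← hg]
    ring

end Conclusion
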